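/- **Theorem 4.5 (Leighton's Theorem for graphs with coloured fins).** *Definitions.* A *graph with fins* $\mathbf X$ is the square complex obtained as the mapping cylinder of a map $\bigsqcup_{\Delta} S\to X$, where $X$ is a graph (a 1-dimensional cube complex; loops and multiple edges are allowed) and $\Delta$ is a family of combinatorial immersions $\gamma:S\to X$, each $S$ being a circle or a bi-infinite line subdivided into $\ell(S)\in\{1,2,\dots,\infty\}$ edges. The copies $S\times\{1\}\subseteq\mathbf X$ are the *fins*; an *oriented fin* $\mathbb S$ is a fin with a choice of orientation, $\ell(\mathbb S):=\ell(S)$, and $\partial_o\mathbf X$ is the set of oriented fins. A *graph with coloured fins* also carries a map $\lambda:\partial_o\mathbf X\to\mathcal C$ to a fixed set $\mathcal C$ of colours. It is *finite* if $\mathbf X$ has finitely many cells; $|X|$ is the number of vertices of $X$. For $\mathbf X$ finite with $X$ non-empty, the *density* of a colour $c$ is $\rho_c(\mathbf X)=\frac{1}{|X|}\sum_{\lambda(\mathbb S)=c}\ell(\mathbb S)$. A *covering* $\Phi:\widehat{\mathbf X}\to\mathbf X$ of graphs with coloured fins is a surjective covering of square complexes that restricts to a graph covering $\widehat X\to X$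 and whose induced map $\partial_o\widehat{\mathbf X}\to\partial_o\mathbf X$ preserves colours; $\mathbf X$ is required to be connected, $\widehat{\mathbf X}$ is not. It is a *universal covering* if $\widehat X$ is a tree. $\mathrm{Aut}(\mathbf X)$ is the group of colour-preserving automorphisms of the square complex $\mathbf X$ that preserve $X$. *Statement.* Let $\mathbf X_1,\mathbf X_2$ be finite graphs with coloured fins (with the same set of colours) that have a common universal cover $\widetilde{\mathbf X}$, with universal coverings $\Psi_i:\widetilde{\mathbf X}\to\mathbf X_i$, and let $\Gamma_i=\{g\in\mathrm{Aut}(\widetilde{\mathbf X}) : \Psi_i\circ g=\Psi_i\}$ be the deck transformation groups. Let $H\le\mathrm{Aut}(\widetilde{\mathbf X})$ be a subgroup that contains $\Gamma_1$ and $\Gamma_2$ and acts transitively on the oriented fins of each colour in $\widetilde{\mathbf X}$. Then $\rho_c(\mathbf X_1)=\rho_c(\mathbf X_2)=:\rho_c$ for every colour $c$, and there are a finite graph with coloured fins $\widehat{\mathbf X}$ and coverings of graphs with coloured fins $\Phi_i:\widehat{\mathbf X}\to\mathbf X_i$ ($i=1,2$) such that $$\sum_{\hat{\mathbb S}\in\Phi_1^{-1}(\mathbb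 S_1)\cap\Phi_2^{-1}(\mathbb S_2)}\ell(\hat{\mathbb S})=\left(\frac{|\widehat X|}{\rho_c\,|X_1|\,|X_2|}\right)\ell(\mathbb S_1)\,\ell(\mathbb S_2)$$ for every colour $c$ and all oriented fins $\mathbb S_1\in\partial_o\mathbf X_1$, $\mathbb S_2\in\partial_o\mathbf X_2$ of colour $c$. -/

import Mathlib

universe u w

/-- A graph in the sense of Serre, i.e. a `1`-dimensional cube complex; loops and multiple edges are
allowed. `E` is the type of *oriented* edges, `rev` reverses the orientation, and the geometric edges
are the pairs `{e, rev e}`. -/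
structure SerreGraph where
  V : Type u
  E : Type u
  src : E → V
  rev : E → E
  rev_rev : ∀ e, rev (rev e) = e
  rev_ne : ∀ e, rev e ≠ e

namespace SerreGraph

/-- The terminal vertex of an oriented edge. -/
def tgt (G : SerreGraph.{u}) (e : G.E) : G.V := G.src (G.rev e)

/-- Any two vertices are joined by an edge path, and there is at least one vertex. -/
def IsConnected (G : SerreGraph.{u}) : Prop :=
  Nonempty G.V ∧
    ∀ x y : G.V, Relation.ReflTransGen (fun a b => ∃ e : G.E, G.src e = a ∧ G.tgt e = b) x y

/-- `G.IsReducedPath x p y`: the list `p` of oriented edges is an edge path without backtracking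
from `x` to `y`. -/
def IsReducedPath (G : SerreGraph.{u}) : G.V → List G.E → G.V → Prop
  | x, [], y => x = y
  | x, e :: p, y => G.src e = x ∧ (∀ e' ∈ p.head?, e' ≠ G.rev e) ∧ G.IsReducedPath (G.tgt e) p y

/-- A tree: any two vertices are joined by exactly one edge path without backtracking. -/
def IsTree (G : SerreGraph.{u}) : Prop :=
  Nonempty G.V ∧ ∀ x y : G.V, ∃! p : List G.E, G.IsReducedPath x p y

/-- Combinatorial maps of graphs: vertices go to vertices and edges to edges. -/
@[ext]
structure Hom (G K : SerreGraph.{u}) where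
  onV : G.V → K.V
  onE : G.E → K.E
  map_src : ∀ e, onV (G.src e) = K.src (onE e)
  map_rev : ∀ e, onE (G.rev e) = K.rev (onE e)

namespace Hom

protected def id (G : SerreGraph.{u}) : Hom G G where
  onV := fun x => x
  onE := fun e => e
  map_src := fun _ => rfl
  map_rev := fun _ => rfl

def comp {G K L : SerreGraph.{u}} (g : Hom K L) (f : Hom G K) : Hom G L where
  onV := fun x => g.onV (f.onV x)
  onE := fun e => g.onE (f.onE e)
  map_src := fun e => by rw [f.map_src, g.map_src]
  map_rev := fun e => by rw [f.map_rev, g.map_rev]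

/-- A combinatorial immersion: a locally injective combinatorial map. -/
def IsImmersion {G K : SerreGraph.{u}} (f : Hom G K) : Prop :=
  ∀ e e' : G.E, G.src e = G.src e' → f.onE e = f.onE e' → e = e'

/-- A graph covering: surjective, and bijective from the star of each vertex to the star of its
image. -/
def IsCovering {G K : SerreGraph.{u}} (f : Hom G K) : Prop :=
  Function.Surjective f.onV ∧
    ∀ (x : G.V) (e' : K.E), K.src e' = f.onV x → ∃! e : G.E, G.src e = x ∧ f.onE e = e'

end Hom

/-- `G.Next e e'`: the oriented edge `e'` continues `e` without backtracking. -/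
def Next (G : SerreGraph.{u}) (e e' : G.E) : Prop := G.src e' = G.tgt e ∧ e' ≠ G.rev e

/-- For a graph all of whose components are subdivided circles or lines, the *oriented components*
of the graph. An orientation of a component is recorded by the oriented edges that point in the
positive direction, and these form a class of the equivalence relation generated by `Next`. Each
component has exactly two such classes, exchanged by `rev`. -/
def OrientedComponent (G : SerreGraph.{u}) : Type u := Quot G.Next

/-- The oriented component in which a given oriented edge points in the positive direction. -/
def orientedComponent (G : SerreGraph.{u}) (e : G.E) : G.OrientedComponent := Quot.mk G.Next e

/-- The length of an oriented component: its number of (positively oriented) edges. It is only used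
for components with finitely many edges. -/
noncomputable def length (G : SerreGraph.{u}) (S : G.OrientedComponent) : ℕ :=
  Nat.card {e : G.E // G.orientedComponent e = S}

/-- The map induced by an immersion on oriented components. -/
def Hom.mapOriented {G K : SerreGraph.{u}} (f : Hom G K) (hf : f.IsImmersion) :
    G.OrientedComponent → K.OrientedComponent :=
  Quot.map f.onE (by
    rintro e e' ⟨h1, h2⟩
    refine ⟨?_, fun h => h2 (hf _ _ h1 ?_)⟩
    · rw [← f.map_src, h1, tgt, f.map_src, f.map_rev, tgt]
    · rw [h, f.map_rev])

end SerreGraph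

/-- A graph with coloured (oriented) fins, the colours being taken from `C`. The graph `fins` is the
disjoint union of the circles and bi-infinite lines `S`: a connected graph is a subdivided circle or
line exactly when each of its vertices has exactly two outgoing oriented edges. The map `attach` is
the union of the immersions `S → X` into the underlying graph `X = base`. The square complex is the
mapping cylinder of `attach`, its fins are the components of `fins`, and its vertical edges and its
squares are indexed by the vertices and the geometric edges of `fins`. The mapping cylinder is
nonpositively curved because `attach` is an immersion. -/
structure GraphWithColouredFins (C : Type w) where
  base : SerreGraph.{u}
  fins : SerreGraph.{u}
  attach : SerreGraph.Hom fins base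
  two_edges : ∀ x : fins.V, Nat.card {e : fins.E // fins.src e = x} = 2
  immersion : attach.IsImmersion
  colour : fins.OrientedComponent → C

namespace GraphWithColouredFins

variable {C : Type w}

/-- The oriented fins. -/
abbrev OrientedFin (X : GraphWithColouredFins.{u} C) : Type u := X.fins.OrientedComponent

/-- The length of an oriented fin. -/
noncomputable abbrev len (X : GraphWithColouredFins.{u} C) (S : X.OrientedFin) : ℕ :=
  X.fins.length S

/-- The number of vertices of the underlying graph. -/
noncomputable def size (X : GraphWithColouredFins.{u} C) : ℕ := Nat.card X.base.V

/-- The square complex has finitely many cells. -/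
def IsFinite (X : GraphWithColouredFins.{u} C) : Prop :=
  Finite X.base.V ∧ Finite X.base.E ∧ Finite X.fins.V ∧ Finite X.fins.E

/-- The density of a colour in a finite graph with coloured fins. -/
noncomputable def density (X : GraphWithColouredFins.{u} C) (c : C) : ℚ :=
  (∑ᶠ S ∈ {S : X.OrientedFin | X.colour S = c}, (X.len S : ℚ)) / X.size

/-- Colour preserving combinatorial maps of graphs with coloured fins: combinatorial maps of the
mapping cylinders that send underlying graph to underlying graph and immerse fins into fins. -/
@[ext]
structure Hom (Y X : GraphWithColouredFins.{u} C) where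
  onBase : SerreGraph.Hom Y.base X.base
  onFins : SerreGraph.Hom Y.fins X.fins
  comm : X.attach.comp onFins = onBase.comp Y.attach
  fins_immersion : onFins.IsImmersion
  map_colour : ∀ S : Y.OrientedFin, X.colour (onFins.mapOriented fins_immersion S) = Y.colour S

namespace Hom

/-- The induced map on oriented fins. -/
def onOrientedFins {Y X : GraphWithColouredFins.{u} C} (Φ : Hom Y X) :
    Y.OrientedFin → X.OrientedFin :=
  Φ.onFins.mapOriented Φ.fins_immersion

protected def id (X : GraphWithColouredFins.{u} C) : Hom X X where
  onBase := SerreGraph.Hom.id _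
  onFins := SerreGraph.Hom.id _
  comm := rfl
  fins_immersion := fun _ _ _ h => h
  map_colour := by rintro ⟨e⟩; rfl

def comp {Z Y X : GraphWithColouredFins.{u} C} (Φ : Hom Y X) (Θ : Hom Z Y) : Hom Z X where
  onBase := Φ.onBase.comp Θ.onBase
  onFins := Φ.onFins.comp Θ.onFins
  comm := by
    change (X.attach.comp Φ.onFins).comp Θ.onFins = Φ.onBase.comp (Θ.onBase.comp Z.attach)
    rw [Φ.comm, ← Θ.comm]
    rfl
  fins_immersion := fun e e' h h' => by
    refine Θ.fins_immersion e e' h (Φ.fins_immersion _ _ ?_ h')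
    rw [← Θ.onFins.map_src, ← Θ.onFins.map_src, h]
  map_colour := by
    rintro ⟨e⟩
    exact (Φ.map_colour (Y.fins.orientedComponent (Θ.onFins.onE e))).trans
      (Θ.map_colour (Z.fins.orientedComponent e))

/-- A covering of graphs with coloured fins: the target is connected, the map restricts to coverings
of the underlying graphs and of the fins, and, for each vertex of the underlying graph, it is
bijective on the vertical edges issuing from that vertex. (It is then also bijective on corners of
squares, and so a covering of square complexes.) -/
def IsCovering {Y X : GraphWithColouredFins.{u} C} (Φ : Hom Y X) : Prop :=
  X.base.IsConnected ∧ Φ.onBase.IsCovering ∧ Φ.onFins.IsCovering ∧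
    ∀ (y : Y.base.V) (v : X.fins.V), X.attach.onV v = Φ.onBase.onV y →
      ∃! v' : Y.fins.V, Y.attach.onV v' = y ∧ Φ.onFins.onV v' = v

/-- A universal covering: a covering by a graph with fins whose underlying graph is a tree. -/
def IsUniversalCovering {Y X : GraphWithColouredFins.{u} C} (Φ : Hom Y X) : Prop :=
  Φ.IsCovering ∧ Y.base.IsTree

end Hom

instance (X : GraphWithColouredFins.{u} C) : Monoid (Hom X X) where
  one := Hom.id X
  mul := Hom.comp
  one_mul := fun _ => rfl
  mul_one := fun _ => rfl
  mul_assoc := fun _ _ _ => rfl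

/-- The group of automorphisms: the invertible maps from `X` to itself. -/
abbrev Aut (X : GraphWithColouredFins.{u} C) : Type u := (Hom X X)ˣ

/-- The deck transformation group of a covering. -/
def deckGroup {Y X : GraphWithColouredFins.{u} C} (Ψ : Hom Y X) : Subgroup (Aut Y) where
  carrier := {h | Ψ.comp h.val = Ψ}
  one_mem' := rfl
  mul_mem' := by
    intro a b ha hb
    change (Ψ.comp a.val).comp b.val = Ψ
    rw [Set.mem_ofPred_eq] at ha hb
    rw [ha, hb]
  inv_mem' := by
    intro a ha
    rw [Set.mem_ofPred_eq] at ha ⊢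
    calc Ψ.comp (a⁻¹).val = (Ψ.comp a.val).comp (a⁻¹).val := by rw [ha]
      _ = Ψ.comp (a.val * (a⁻¹).val) := rfl
      _ = Ψ := by rw [Units.mul_inv]; rfl

/-- The oriented fins that cover both `S₁` and `S₂`. -/
def commonFins {Y X₁ X₂ : GraphWithColouredFins.{u} C} (Φ₁ : Hom Y X₁) (Φ₂ : Hom Y X₂)
    (S₁ : X₁.OrientedFin) (S₂ : X₂.OrientedFin) : Set Y.OrientedFin :=
  {S | Φ₁.onOrientedFins S = S₁ ∧ Φ₂.onOrientedFins S = S₂}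

end GraphWithColouredFins

/-! Write T for the common universal cover and G for its automorphism group. An element g of G
identifies the star of a vertex x of T, fins included, with the star of g x, and hence the star of
Ψ₁ x in X₁ with the star of Ψ₂ (g x) in X₂. There are only finitely many such identifications,
called germs. The common covering is built from w r copies of each germ r, glued along oriented
edges. A gluing exists as soon as each identification of an oriented edge with its fins occurs in as
many pieces as its reverse (`exists_involution`). The maps Ψ₁ and Ψ₂ g on the pieces then fit
together to two coverings (`hom_isCovering`).

The weights make the counts balance. Let n(x) be the number of vertices of X₁ in the image of G x,
and choose w r so that w r times n(x) [G_x : Fix(star x)] is a constant N. For Fix(star x) ≤ L ≤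
G_x, a class of germs of the form g L has [L : Fix(star x)] members, so it contributes N / (n(x)
[G_x : L]) pieces (`card_weighted_germs`). If L fixes an edge e at x and the fins along e, orbit
counting turns the denominator into the number of edges of X₁ in the image of G e, times [G_e : L].
This does not change when e is reversed, so the gluing is possible. If L is the stabiliser of an
edge f of a fin, the pair (Ψ₁ f, Ψ₂ (g f)) is seen to occur N / m(f) times, where m(f) counts the
edges in the image of G f (`exists_common_covering`).

Moving along a fin and using transitivity on the oriented fins of a colour shows that m(f), and the
part of this count lying in a fixed S₁, depend only on the colour of f (`ncard_finEdge_orbit_eq`).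
Hence the number R of edges of the common covering over S₁ and over one edge z of X₂ is the same for
all z of colour c (`card_row`). With d the degree over X₁ and n₂ the number of oriented fin edges of
colour c in X₂, summing over z gives ℓ(S₁) d = n₂ R, while the edges over both S₁ and S₂ number
ℓ(S₂) R. Substituting d = |X̂| / |X₁| and n₂ = ρ_c |X₂| gives the formula. The densities agree
because a finite covering preserves them. -/

namespace SerreGraph

/-! ### Reduced paths and lifting for coverings by trees. -/

variable {G K L : SerreGraph.{u}}

/-- Two vertices are joined by an edge path. -/
def Reachable (G : SerreGraph.{u}) : G.V → G.V → Prop :=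
  Relation.ReflTransGen (fun a b => ∃ e : G.E, G.src e = a ∧ G.tgt e = b)

@[simp] lemma src_rev (e : G.E) : G.src (G.rev e) = G.tgt e := rfl

@[simp] lemma tgt_rev (e : G.E) : G.tgt (G.rev e) = G.src e := by
  rw [tgt, G.rev_rev]

lemma rev_injective (G : SerreGraph.{u}) : Function.Injective G.rev :=
  Function.LeftInverse.injective G.rev_rev

namespace Hom

lemma map_tgt (f : Hom G K) (e : G.E) : f.onV (G.tgt e) = K.tgt (f.onE e) := by
  rw [tgt, f.map_src, f.map_rev, tgt]

lemma IsCovering.isImmersion {f : Hom G K} (hf : f.IsCovering) : f.IsImmersion := by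
  intro e e' h h'
  obtain ⟨_, _, hu⟩ := hf.2 (G.src e) (f.onE e) (f.map_src e).symm
  rw [hu e ⟨rfl, rfl⟩, hu e' ⟨h.symm, h'.symm⟩]

end Hom

lemma Reachable.symm {x y : G.V} (h : G.Reachable x y) : G.Reachable y x := by
  induction h with
  | refl => exact .refl
  | tail _ h ih =>
    obtain ⟨e, he, he'⟩ := h
    exact Relation.ReflTransGen.head ⟨G.rev e, he', by rw [tgt_rev, he]⟩ ih

lemma Reachable.exists_isReducedPath {x y : G.V} (h : G.Reachable x y) :
    ∃ p, G.IsReducedPath x p y := by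
  induction h using Relation.ReflTransGen.head_induction_on with
  | refl => exact ⟨[], rfl⟩
  | head h _ ih =>
    obtain ⟨e, rfl, rfl⟩ := h
    obtain ⟨p, hp⟩ := ih
    match p, hp with
    | [], hp => exact ⟨[e], rfl, by simp, hp⟩
    | e' :: p, hp =>
      by_cases h : e' = G.rev e
      · subst h
        exact ⟨p, by simpa using hp.2.2⟩
      · exact ⟨e :: e' :: p, rfl, by simpa using h, hp⟩

lemma IsReducedPath.reachable {x y : G.V} {p : List G.E} (h : G.IsReducedPath x p y) :
    G.Reachable x y := by
  induction p generalizing x with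
  | nil => cases h; exact .refl
  | cons e p ih => exact Relation.ReflTransGen.head ⟨e, h.1, rfl⟩ (ih h.2.2)

/-- A backtrack in the image would involve two edges issuing from one vertex with the same image, so
local injectivity pulls it back to a backtrack in the source. -/
lemma Hom.IsImmersion.isReducedPath_map {f : Hom G K} (hf : f.IsImmersion) {x y : G.V}
    {p : List G.E} (h : G.IsReducedPath x p y) :
    K.IsReducedPath (f.onV x) (p.map f.onE) (f.onV y) := by
  induction p generalizing x with
  | nil => cases h; rfl
  | cons e p ih =>
    obtain ⟨h1, h2, h3⟩ := h
    refine ⟨by rw [← f.map_src, h1], ?_, by rw [← f.map_tgt]; exact ih h3⟩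
    match p, h2, h3 with
    | [], _, _ => simp
    | e' :: p, h2, h3 =>
      simp only [List.map_cons, List.head?_cons, Option.mem_def, Option.some.injEq, forall_eq']
        at h2 ⊢
      rw [← f.map_rev]
      exact fun h => h2 (hf _ _ (by rw [h3.1, src_rev]) h)

lemma IsTree.reachable (hK : K.IsTree) (x y : K.V) : K.Reachable x y :=
  (hK.2 x y).exists.choose_spec.reachable

/-- An immersion to a tree is injective on each connected component. -/
lemma Hom.IsImmersion.injOn_of_isTree {f : Hom G K} (hf : f.IsImmersion) (hK : K.IsTree)
    {x y : G.V} (h : G.Reachable x y) (hxy : f.onV x = f.onV y) : x = y := by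
  obtain ⟨p, hp⟩ := h.exists_isReducedPath
  have h1 := hf.isReducedPath_map hp
  rw [hxy] at h1
  have h2 := (hK.2 _ _).unique h1 (y₂ := []) rfl
  rw [List.map_eq_nil_iff] at h2
  subst h2
  exact hp

/-- The fibre product of a map of graphs with itself. -/
def fibreSquare (p : Hom G K) : SerreGraph.{u} where
  V := {q : G.V × G.V // p.onV q.1 = p.onV q.2}
  E := {q : G.E × G.E // p.onE q.1 = p.onE q.2}
  src e := ⟨(G.src e.1.1, G.src e.1.2), by rw [p.map_src, p.map_src, e.2]⟩
  rev e := ⟨(G.rev e.1.1, G.rev e.1.2), by rw [p.map_rev, p.map_rev, e.2]⟩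
  rev_rev e := by simp [G.rev_rev]
  rev_ne e h := G.rev_ne e.1.1 (congrArg (fun q => q.1.1) h)

def fibreSquareFst (p : Hom G K) : Hom (fibreSquare p) G where
  onV q := q.1.1
  onE q := q.1.1
  map_src _ := rfl
  map_rev _ := rfl

lemma fibreSquareFst_isImmersion {p : Hom G K} (hp : p.IsImmersion) :
    (fibreSquareFst p).IsImmersion := by
  rintro ⟨⟨e₁, e₂⟩, h⟩ ⟨⟨e₁', e₂'⟩, h'⟩ hs he
  have h1 : e₁ = e₁' := he
  subst h1
  have h2 : G.src e₂ = G.src e₂' := congrArg (fun q => q.1.2) hs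
  have h3 := hp _ _ h2 (h.symm.trans h')
  subst h3
  rfl

/-- Unique lifting: endomorphisms over `p` of a connected graph that agree at a vertex are equal. -/
lemma Hom.eq_of_isImmersion {p : Hom K L} (hp : p.IsImmersion) (hG : ∀ x y, G.Reachable x y)
    {f g : Hom G K} (hfg : p.comp f = p.comp g) (a : G.V) (ha : f.onV a = g.onV a) : f = g := by
  have hE : ∀ e : G.E, p.onE (f.onE e) = p.onE (g.onE e) := fun e =>
    congrArg (fun h : Hom G L => h.onE e) hfg
  have key : ∀ e : G.E, f.onV (G.src e) = g.onV (G.src e) → f.onE e = g.onE e := fun e he =>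
    hp _ _ (by rw [← f.map_src, he, g.map_src]) (hE e)
  have hV : ∀ y, f.onV y = g.onV y := by
    intro y
    induction hG a y with
    | refl => exact ha
    | tail _ h ih =>
      obtain ⟨e, rfl, rfl⟩ := h
      rw [f.map_tgt, g.map_tgt, key e ih]
  exact Hom.ext (funext hV) (funext fun e => key e (hV _))

/-- Lifting of a covering of a tree through itself. -/
lemma Hom.IsCovering.exists_lift {p : Hom G K} (hp : p.IsCovering) (hG : G.IsTree) {a b : G.V}
    (hab : p.onV a = p.onV b) : ∃ f : Hom G G, p.comp f = p ∧ f.onV a = b := by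
  -- The graph of the lift is the component of (a, b) in the fibre square. Path lifting makes it
  -- defined everywhere.
  let R (y z : G.V) : Prop :=
    ∃ h : p.onV y = p.onV z, (fibreSquare p).Reachable ⟨(a, b), hab⟩ ⟨(y, z), h⟩
  have hex : ∀ y, ∃ z, R y z := by
    intro y
    induction hG.reachable a y with
    | refl => exact ⟨b, hab, .refl⟩
    | tail _ h ih =>
      obtain ⟨e, rfl, rfl⟩ := h
      obtain ⟨z, hz, hR⟩ := ih
      obtain ⟨e', ⟨rfl, he'⟩, _⟩ := hp.2 z (p.onE e) (by rw [← hz, p.map_src])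
      exact ⟨G.tgt e', by rw [p.map_tgt, p.map_tgt, he'],
        Relation.ReflTransGen.tail hR ⟨⟨(e, e'), he'.symm⟩, rfl, rfl⟩⟩
  -- Single-valued because the first projection of the fibre square is an immersion into a tree,
  -- hence injective on each component.
  have huniq : ∀ y z z', R y z → R y z' → z = z' := by
    rintro y z z' ⟨h, hR⟩ ⟨h', hR'⟩
    have := (fibreSquareFst_isImmersion hp.isImmersion).injOn_of_isTree hG
      (hR.symm.trans hR') rfl
    exact congrArg (fun q => q.1.2) this
  choose φ hφ using hex
  have hφ' : ∀ y, p.onV y = p.onV (φ y) := fun y => (hφ y).1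
  have hE : ∀ e : G.E, ∃ e', G.src e' = φ (G.src e) ∧ p.onE e' = p.onE e := fun e =>
    (hp.2 (φ (G.src e)) (p.onE e) (by rw [← hφ', p.map_src])).exists
  choose ψ hψ hψ' using hE
  have ht : ∀ e, φ (G.tgt e) = G.tgt (ψ e) := by
    intro e
    refine huniq _ _ _ (hφ _) ?_
    obtain ⟨h, hR⟩ := hφ (G.src e)
    refine ⟨by rw [p.map_tgt, p.map_tgt, hψ'], Relation.ReflTransGen.tail hR
      ⟨⟨(e, ψ e), (hψ' e).symm⟩, ?_, rfl⟩⟩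
    exact Subtype.ext (Prod.ext rfl (hψ e))
  refine ⟨⟨φ, ψ, fun e => (hψ e).symm, fun e => ?_⟩, Hom.ext ?_ ?_, ?_⟩
  · refine hp.isImmersion _ _ ?_ ?_
    · rw [hψ, src_rev, ht, src_rev]
    · rw [hψ', p.map_rev, p.map_rev, hψ']
  · exact funext fun y => (hφ' y).symm
  · exact funext hψ'
  · exact huniq _ _ _ (hφ a) ⟨hab, .refl⟩

end SerreGraph

/-! ### Coverings of graphs with fins and transitivity of deck groups on fibres. -/

namespace GraphWithColouredFins

variable {C : Type w} {X Y : GraphWithColouredFins.{u} C}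

/-- The vertex of the underlying graph above which an oriented edge of a fin starts. -/
def foot (X : GraphWithColouredFins.{u} C) (f : X.fins.E) : X.base.V :=
  X.base.src (X.attach.onE f)

lemma attach_src (f : X.fins.E) : X.attach.onV (X.fins.src f) = X.foot f := X.attach.map_src f

namespace Hom

lemma attach_onV (Φ : Hom Y X) (v : Y.fins.V) :
    X.attach.onV (Φ.onFins.onV v) = Φ.onBase.onV (Y.attach.onV v) :=
  congrArg (fun h : SerreGraph.Hom Y.fins X.base => h.onV v) Φ.comm

lemma attach_onE (Φ : Hom Y X) (f : Y.fins.E) :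
    X.attach.onE (Φ.onFins.onE f) = Φ.onBase.onE (Y.attach.onE f) :=
  congrArg (fun h : SerreGraph.Hom Y.fins X.base => h.onE f) Φ.comm

lemma foot_onE (Φ : Hom Y X) (f : Y.fins.E) :
    X.foot (Φ.onFins.onE f) = Φ.onBase.onV (Y.foot f) := by
  rw [foot, attach_onE, foot, Φ.onBase.map_src]

lemma colour_onE (Φ : Hom Y X) (f : Y.fins.E) :
    X.colour (X.fins.orientedComponent (Φ.onFins.onE f)) =
      Y.colour (Y.fins.orientedComponent f) :=
  Φ.map_colour (Y.fins.orientedComponent f)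

namespace IsCovering

variable {Φ : Hom Y X}

lemma edge_unique (hΦ : Φ.IsCovering) {e e' : Y.base.E} (h : Y.base.src e = Y.base.src e')
    (h' : Φ.onBase.onE e = Φ.onBase.onE e') : e = e' :=
  hΦ.2.1.isImmersion e e' h h'

lemma exists_edge (hΦ : Φ.IsCovering) {y : Y.base.V} {e : X.base.E}
    (h : X.base.src e = Φ.onBase.onV y) : ∃ e', Y.base.src e' = y ∧ Φ.onBase.onE e' = e :=
  (hΦ.2.1.2 y e h).exists

lemma finVertex_unique (hΦ : Φ.IsCovering) {v v' : Y.fins.V}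
    (h : Y.attach.onV v = Y.attach.onV v') (h' : Φ.onFins.onV v = Φ.onFins.onV v') : v = v' :=
  (hΦ.2.2.2 (Y.attach.onV v) (Φ.onFins.onV v) (Φ.attach_onV v)).unique ⟨rfl, rfl⟩
    ⟨h.symm, h'.symm⟩

lemma exists_finVertex (hΦ : Φ.IsCovering) {y : Y.base.V} {v : X.fins.V}
    (h : X.attach.onV v = Φ.onBase.onV y) : ∃ v', Y.attach.onV v' = y ∧ Φ.onFins.onV v' = v :=
  (hΦ.2.2.2 y v h).exists

lemma finEdge_unique (hΦ : Φ.IsCovering) {f f' : Y.fins.E} (h : Y.foot f = Y.foot f')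
    (h' : Φ.onFins.onE f = Φ.onFins.onE f') : f = f' := by
  refine hΦ.2.2.1.isImmersion f f' (hΦ.finVertex_unique ?_ ?_) h'
  · rw [attach_src, attach_src, h]
  · rw [Φ.onFins.map_src, Φ.onFins.map_src, h']

lemma exists_finEdge (hΦ : Φ.IsCovering) {y : Y.base.V} {f : X.fins.E}
    (h : X.foot f = Φ.onBase.onV y) : ∃ f', Y.foot f' = y ∧ Φ.onFins.onE f' = f := by
  obtain ⟨v, hv, hv'⟩ := hΦ.exists_finVertex ((attach_src f).trans h)
  obtain ⟨f', ⟨hf, hf'⟩, _⟩ := hΦ.2.2.1.2 v f hv'.symm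
  exact ⟨f', by rw [← attach_src, hf, hv], hf'⟩

lemma finEdge_unique_of_attach (hΦ : Φ.IsCovering) {f f' : Y.fins.E}
    (h : Y.attach.onE f = Y.attach.onE f')
    (h' : Φ.onFins.onE f = Φ.onFins.onE f') : f = f' :=
  hΦ.finEdge_unique (congrArg Y.base.src h) h'

lemma exists_finEdge_attach (hΦ : Φ.IsCovering) {e : Y.base.E} {f : X.fins.E}
    (h : X.attach.onE f = Φ.onBase.onE e) : ∃ f', Y.attach.onE f' = e ∧ Φ.onFins.onE f' = f := by
  obtain ⟨f', h1, h2⟩ := hΦ.exists_finEdge (y := Y.base.src e) (f := f)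
    (by rw [foot, h, Φ.onBase.map_src])
  exact ⟨f', hΦ.edge_unique h1 (by rw [← attach_onE, h2, h]), h2⟩

/-- A lift of the underlying graph extends uniquely to the fins. -/
lemma exists_extension (hΦ : Φ.IsCovering) {f : SerreGraph.Hom Y.base Y.base}
    (hf : Φ.onBase.comp f = Φ.onBase) : ∃ g : Hom Y Y, g.onBase = f ∧ Φ.comp g = Φ := by
  have hfV : ∀ y, Φ.onBase.onV (f.onV y) = Φ.onBase.onV y := fun y =>
    congrArg (fun h : SerreGraph.Hom Y.base X.base => h.onV y) hf
  have hfE : ∀ y, Φ.onBase.onE (f.onE y) = Φ.onBase.onE y := fun y =>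
    congrArg (fun h : SerreGraph.Hom Y.base X.base => h.onE y) hf
  have hV : ∀ v, ∃ v', Y.attach.onV v' = f.onV (Y.attach.onV v) ∧
      Φ.onFins.onV v' = Φ.onFins.onV v := fun v =>
    hΦ.exists_finVertex (by rw [attach_onV, hfV])
  have hE : ∀ e, ∃ e', Y.attach.onE e' = f.onE (Y.attach.onE e) ∧
      Φ.onFins.onE e' = Φ.onFins.onE e := fun e =>
    hΦ.exists_finEdge_attach (by rw [attach_onE, hfE])
  choose φ h1 h2 using hV
  choose ψ h3 h4 using hE
  let F : SerreGraph.Hom Y.fins Y.fins := ⟨φ, ψ, fun e => ?_, fun e => ?_⟩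
  · have hF : Φ.onFins.comp F = Φ.onFins := SerreGraph.Hom.ext (funext h2) (funext h4)
    have hi : F.IsImmersion := fun e e' hs he =>
      hΦ.2.2.1.isImmersion e e' hs ((h4 e).symm.trans ((congrArg Φ.onFins.onE he).trans (h4 e')))
    refine ⟨⟨f, F, SerreGraph.Hom.ext (funext h1) (funext h3), hi, ?_⟩, rfl,
      Hom.ext hf hF⟩
    rintro ⟨e⟩
    have := Φ.colour_onE (ψ e)
    rw [h4, colour_onE] at this
    exact this.symm
  · refine hΦ.finVertex_unique ?_ ?_
    · rw [h1, attach_src, attach_src, foot, foot, h3, f.map_src]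
    · rw [h2, Φ.onFins.map_src, Φ.onFins.map_src, h4]
  · refine hΦ.finEdge_unique_of_attach ?_ ?_
    · rw [h3, Y.attach.map_rev, f.map_rev, Y.attach.map_rev, h3]
    · rw [h4, Φ.onFins.map_rev, Φ.onFins.map_rev, h4]

lemma comp_aut (hΦ : Φ.IsCovering) (g : Aut Y) : (Φ.comp g.val).IsCovering := by
  have hg : g.val.comp (g⁻¹).val = Hom.id Y := by
    change g.val * (g⁻¹).val = 1
    rw [Units.mul_inv]
  have hg' : (g⁻¹).val.comp g.val = Hom.id Y := by
    change (g⁻¹).val * g.val = 1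
    rw [Units.inv_mul]
  have bV : ∀ y, g.val.onBase.onV ((g⁻¹).val.onBase.onV y) = y := fun y =>
    congrArg (fun h : Hom Y Y => h.onBase.onV y) hg
  have bE : ∀ y, g.val.onBase.onE ((g⁻¹).val.onBase.onE y) = y := fun y =>
    congrArg (fun h : Hom Y Y => h.onBase.onE y) hg
  have fV : ∀ y, g.val.onFins.onV ((g⁻¹).val.onFins.onV y) = y := fun y =>
    congrArg (fun h : Hom Y Y => h.onFins.onV y) hg
  have fE : ∀ y, g.val.onFins.onE ((g⁻¹).val.onFins.onE y) = y := fun y =>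
    congrArg (fun h : Hom Y Y => h.onFins.onE y) hg
  have bV' : ∀ y, (g⁻¹).val.onBase.onV (g.val.onBase.onV y) = y := fun y =>
    congrArg (fun h : Hom Y Y => h.onBase.onV y) hg'
  have bE' : ∀ y, (g⁻¹).val.onBase.onE (g.val.onBase.onE y) = y := fun y =>
    congrArg (fun h : Hom Y Y => h.onBase.onE y) hg'
  have fV' : ∀ y, (g⁻¹).val.onFins.onV (g.val.onFins.onV y) = y := fun y =>
    congrArg (fun h : Hom Y Y => h.onFins.onV y) hg'
  have fE' : ∀ y, (g⁻¹).val.onFins.onE (g.val.onFins.onE y) = y := fun y =>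
    congrArg (fun h : Hom Y Y => h.onFins.onE y) hg'
  refine ⟨hΦ.1, ⟨fun x => ?_, fun y e h => ?_⟩, ⟨fun v => ?_, fun v e h => ?_⟩, fun y v h => ?_⟩
  · obtain ⟨y, hy⟩ := hΦ.2.1.1 x
    exact ⟨(g⁻¹).val.onBase.onV y, (congrArg Φ.onBase.onV (bV y)).trans hy⟩
  · obtain ⟨e', ⟨h1, h2⟩, h3⟩ := hΦ.2.1.2 _ e h
    refine ⟨(g⁻¹).val.onBase.onE e', ⟨?_, (congrArg Φ.onBase.onE (bE e')).trans h2⟩, ?_⟩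
    · rw [← (g⁻¹).val.onBase.map_src, h1, bV']
    · rintro e'' ⟨rfl, h5⟩
      rw [← h3 (g.val.onBase.onE e'') ⟨(g.val.onBase.map_src _).symm, h5⟩, bE']
  · obtain ⟨y, hy⟩ := hΦ.2.2.1.1 v
    exact ⟨(g⁻¹).val.onFins.onV y, (congrArg Φ.onFins.onV (fV y)).trans hy⟩
  · obtain ⟨e', ⟨h1, h2⟩, h3⟩ := hΦ.2.2.1.2 _ e h
    refine ⟨(g⁻¹).val.onFins.onE e', ⟨?_, (congrArg Φ.onFins.onE (fE e')).trans h2⟩, ?_⟩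
    · rw [← (g⁻¹).val.onFins.map_src, h1, fV']
    · rintro e'' ⟨rfl, h5⟩
      rw [← h3 (g.val.onFins.onE e'') ⟨(g.val.onFins.map_src _).symm, h5⟩, fE']
  · obtain ⟨v', ⟨h1, h2⟩, h3⟩ := hΦ.2.2.2 _ v h
    refine ⟨(g⁻¹).val.onFins.onV v', ⟨?_, (congrArg Φ.onFins.onV (fV v')).trans h2⟩, ?_⟩
    · rw [attach_onV, h1, bV']
    · rintro v'' ⟨rfl, h5⟩
      rw [← h3 (g.val.onFins.onV v'') ⟨g.val.attach_onV v'', h5⟩, fV']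

end IsCovering

/-- A map over a universal covering is determined by the image of one vertex. -/
lemma IsUniversalCovering.eq_of_comp_eq {Ψ : Hom Y X} (hΨ : Ψ.IsUniversalCovering)
    {f g : Hom Y Y} (hf : Ψ.comp f = Ψ) (hg : Ψ.comp g = Ψ) (a : Y.base.V)
    (h : f.onBase.onV a = g.onBase.onV a) : f = g := by
  have hb : f.onBase = g.onBase :=
    SerreGraph.Hom.eq_of_isImmersion hΨ.1.2.1.isImmersion hΨ.2.reachable
      ((congrArg onBase hf).trans (congrArg onBase hg).symm) a h
  have hE : ∀ e, Ψ.onFins.onE (f.onFins.onE e) = Ψ.onFins.onE (g.onFins.onE e) := fun e =>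
    congrArg (fun h : Hom Y X => h.onFins.onE e) (hf.trans hg.symm)
  have hV : ∀ e, Ψ.onFins.onV (f.onFins.onV e) = Ψ.onFins.onV (g.onFins.onV e) := fun e =>
    congrArg (fun h : Hom Y X => h.onFins.onV e) (hf.trans hg.symm)
  refine Hom.ext hb (SerreGraph.Hom.ext (funext fun v => ?_) (funext fun e => ?_))
  · exact hΨ.1.finVertex_unique (by rw [attach_onV, attach_onV, hb]) (hV v)
  · exact hΨ.1.finEdge_unique (by rw [foot_onE, foot_onE, hb]) (hE e)

/-- The deck transformation group of a universal covering is transitive on the fibres. -/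
lemma IsUniversalCovering.exists_deck {Ψ : Hom Y X} (hΨ : Ψ.IsUniversalCovering)
    {a b : Y.base.V} (hab : Ψ.onBase.onV a = Ψ.onBase.onV b) :
    ∃ g ∈ deckGroup Ψ, g.val.onBase.onV a = b := by
  have key : ∀ {a b : Y.base.V}, Ψ.onBase.onV a = Ψ.onBase.onV b →
      ∃ g : Hom Y Y, Ψ.comp g = Ψ ∧ g.onBase.onV a = b := by
    intro a b hab
    obtain ⟨f, hf, hfa⟩ := hΨ.1.2.1.exists_lift hΨ.2 hab
    obtain ⟨g, rfl, hg⟩ := hΨ.1.exists_extension hf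
    exact ⟨g, hg, hfa⟩
  obtain ⟨f, hf, hfa⟩ := key hab
  obtain ⟨g, hg, hgb⟩ := key hab.symm
  have comp_eq : ∀ {p q : Hom Y Y}, Ψ.comp p = Ψ → Ψ.comp q = Ψ → Ψ.comp (p.comp q) = Ψ := by
    intro p q hp hq
    change (Ψ.comp p).comp q = Ψ
    rw [hp, hq]
  -- The lifts taking a to b and b to a are mutually inverse, since each composite lies over Ψ and
  -- fixes a vertex.
  have h1 : f * g = 1 := hΨ.eq_of_comp_eq (comp_eq hf hg) rfl b
    ((congrArg f.onBase.onV hgb).trans hfa)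
  have h2 : g * f = 1 := hΨ.eq_of_comp_eq (comp_eq hg hf) rfl a
    ((congrArg g.onBase.onV hfa).trans hgb)
  exact ⟨⟨f, g, h1, h2⟩, hf, hfa⟩

end Hom

instance : MulAction (Aut X) X.base.V where
  smul g x := g.val.onBase.onV x
  one_smul _ := rfl
  mul_smul _ _ _ := rfl

instance : MulAction (Aut X) X.base.E where
  smul g x := g.val.onBase.onE x
  one_smul _ := rfl
  mul_smul _ _ _ := rfl

instance : MulAction (Aut X) X.fins.E where
  smul g x := g.val.onFins.onE x
  one_smul _ := rfl
  mul_smul _ _ _ := rfl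

lemma src_smul (g : Aut X) (e : X.base.E) : X.base.src (g • e) = g • X.base.src e :=
  (g.val.onBase.map_src e).symm

lemma rev_smul (g : Aut X) (e : X.base.E) : X.base.rev (g • e) = g • X.base.rev e :=
  (g.val.onBase.map_rev e).symm

lemma finRev_smul (g : Aut X) (f : X.fins.E) : X.fins.rev (g • f) = g • X.fins.rev f :=
  (g.val.onFins.map_rev f).symm

lemma attach_smul (g : Aut X) (f : X.fins.E) : X.attach.onE (g • f) = g • X.attach.onE f :=
  g.val.attach_onE f

lemma foot_smul (g : Aut X) (f : X.fins.E) : X.foot (g • f) = g • X.foot f :=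
  g.val.foot_onE f

section Deck

variable {Ψ : Hom Y X} {γ : Aut Y}

lemma onV_deck (hγ : γ ∈ deckGroup Ψ) (x : Y.base.V) :
    Ψ.onBase.onV (γ • x) = Ψ.onBase.onV x :=
  congrArg (fun h : Hom Y X => h.onBase.onV x) (show Ψ.comp γ.val = Ψ from hγ)

lemma onE_deck (hγ : γ ∈ deckGroup Ψ) (x : Y.base.E) :
    Ψ.onBase.onE (γ • x) = Ψ.onBase.onE x :=
  congrArg (fun h : Hom Y X => h.onBase.onE x) (show Ψ.comp γ.val = Ψ from hγ)

lemma finOnE_deck (hγ : γ ∈ deckGroup Ψ) (x : Y.fins.E) :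
    Ψ.onFins.onE (γ • x) = Ψ.onFins.onE x :=
  congrArg (fun h : Hom Y X => h.onFins.onE x) (show Ψ.comp γ.val = Ψ from hγ)

lemma Hom.IsUniversalCovering.exists_smul_eq (hΨ : Ψ.IsUniversalCovering) {a b : Y.base.V}
    (hab : Ψ.onBase.onV a = Ψ.onBase.onV b) : ∃ γ ∈ deckGroup Ψ, γ • a = b :=
  hΨ.exists_deck hab

lemma Hom.IsUniversalCovering.exists_smul_edge_eq (hΨ : Ψ.IsUniversalCovering) {a b : Y.base.E}
    (hab : Ψ.onBase.onE a = Ψ.onBase.onE b) : ∃ γ ∈ deckGroup Ψ, γ • a = b := by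
  obtain ⟨γ, hγ, h⟩ := hΨ.exists_smul_eq (a := Y.base.src a) (b := Y.base.src b)
    (by rw [Ψ.onBase.map_src, hab, Ψ.onBase.map_src])
  exact ⟨γ, hγ, hΨ.1.edge_unique (by rw [src_smul, h]) (by rw [onE_deck hγ, hab])⟩

lemma Hom.IsUniversalCovering.exists_smul_finEdge_eq (hΨ : Ψ.IsUniversalCovering)
    {a b : Y.fins.E} (hab : Ψ.onFins.onE a = Ψ.onFins.onE b) : ∃ γ ∈ deckGroup Ψ, γ • a = b := by
  obtain ⟨γ, hγ, h⟩ := hΨ.exists_smul_eq (a := Y.foot a) (b := Y.foot b)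
    (by rw [← Ψ.foot_onE, hab, Ψ.foot_onE])
  exact ⟨γ, hγ, hΨ.1.finEdge_unique (by rw [foot_smul, h]) (by rw [finOnE_deck hγ, hab])⟩

end Deck

end GraphWithColouredFins

/-! ### Gluing stars of vertices. -/

namespace GraphWithColouredFins

variable {C : Type w} {X T : GraphWithColouredFins.{u} C}

/-- Data for gluing stars of vertices of `T` along their oriented edges: a family of vertices of
`T`, and an involution on the oriented edges issuing from them which lifts to the edges of the
fins. -/
structure Gluing (T : GraphWithColouredFins.{u} C) where
  I : Type u
  pt : I → T.base.V
  rev : {p : I × T.base.E // T.base.src p.2 = pt p.1} →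
    {p : I × T.base.E // T.base.src p.2 = pt p.1}
  rev_rev : ∀ e, rev (rev e) = e
  rev_ne : ∀ e, rev e ≠ e
  finRev : {p : I × T.fins.E // T.foot p.2 = pt p.1} → {p : I × T.fins.E // T.foot p.2 = pt p.1}
  finRev_finRev : ∀ f, finRev (finRev f) = f
  attach_finRev : ∀ f, rev ⟨(f.1.1, T.attach.onE f.1.2), f.2⟩ =
    ⟨((finRev f).1.1, T.attach.onE (finRev f).1.2), (finRev f).2⟩

namespace Gluing

variable (D : Gluing T)

/-- The glued underlying graph. -/
def base : SerreGraph.{u} where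
  V := D.I
  E := {p : D.I × T.base.E // T.base.src p.2 = D.pt p.1}
  src e := e.1.1
  rev := D.rev
  rev_rev := D.rev_rev
  rev_ne := D.rev_ne

/-- The glued fins. -/
def fins : SerreGraph.{u} where
  V := {p : D.I × T.fins.V // T.attach.onV p.2 = D.pt p.1}
  E := {p : D.I × T.fins.E // T.foot p.2 = D.pt p.1}
  src f := ⟨(f.1.1, T.fins.src f.1.2), (attach_src _).trans f.2⟩
  rev := D.finRev
  rev_rev := D.finRev_finRev
  rev_ne f h := D.rev_ne ⟨(f.1.1, T.attach.onE f.1.2), f.2⟩ (by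
    rw [D.attach_finRev]
    exact Subtype.ext (congrArg (fun p => (p.1.1, T.attach.onE p.1.2)) h))

def attach : SerreGraph.Hom D.fins D.base where
  onV v := v.1.1
  onE f := ⟨(f.1.1, T.attach.onE f.1.2), f.2⟩
  map_src _ := rfl
  map_rev f := (D.attach_finRev f).symm

lemma attach_isImmersion : D.attach.IsImmersion := by
  rintro ⟨⟨i, f⟩, h⟩ ⟨⟨j, f'⟩, h'⟩ hs he
  have h1 : i = j := congrArg (fun v => v.1.1) hs
  have h2 : T.fins.src f = T.fins.src f' := congrArg (fun v => v.1.2) hs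
  have h3 : T.attach.onE f = T.attach.onE f' := congrArg (fun v => v.1.2) he
  subst h1
  have h4 := T.immersion f f' h2 h3
  subst h4
  rfl

lemma two_edges (v : D.fins.V) : Nat.card {f : D.fins.E // D.fins.src f = v} = 2 := by
  rw [← T.two_edges v.1.2]
  refine Nat.card_congr ⟨fun f => ⟨f.1.1.2, congrArg (fun v => v.1.2) f.2⟩,
    fun f => ⟨⟨(v.1.1, f.1), by rw [← attach_src, f.2, v.2]⟩,
      Subtype.ext (Prod.ext rfl f.2)⟩, ?_, fun f => rfl⟩
  rintro ⟨⟨⟨i, f⟩, h⟩, rfl⟩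
  rfl

/-- A family of maps of `T` that is compatible with the gluing. -/
structure CompatibleFamily (X : GraphWithColouredFins.{u} C) where
  map : D.I → Hom T X
  rev : ∀ e, (map (D.rev e).1.1).onBase.onE (D.rev e).1.2 =
    X.base.rev ((map e.1.1).onBase.onE e.1.2)
  finRev : ∀ f, (map (D.finRev f).1.1).onFins.onE (D.finRev f).1.2 =
    X.fins.rev ((map f.1.1).onFins.onE f.1.2)

namespace CompatibleFamily

variable {D} (p : D.CompatibleFamily X)

def baseHom : SerreGraph.Hom D.base X.base where
  onV i := (p.map i).onBase.onV (D.pt i)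
  onE e := (p.map e.1.1).onBase.onE e.1.2
  map_src e := by
    rw [← (p.map e.1.1).onBase.map_src, e.2]
    rfl
  map_rev := p.rev

def finsHom : SerreGraph.Hom D.fins X.fins where
  onV v := (p.map v.1.1).onFins.onV v.1.2
  onE f := (p.map f.1.1).onFins.onE f.1.2
  map_src f := (p.map f.1.1).onFins.map_src f.1.2
  map_rev := p.finRev

lemma finsHom_isImmersion : p.finsHom.IsImmersion := by
  rintro ⟨⟨i, f⟩, h⟩ ⟨⟨j, f'⟩, h'⟩ hs he
  have h1 : i = j := congrArg (fun v => v.1.1) hs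
  have h2 : T.fins.src f = T.fins.src f' := congrArg (fun v => v.1.2) hs
  subst h1
  have h3 := (p.map i).fins_immersion f f' h2 he
  subst h3
  rfl

/-- The glued graph with fins, coloured by means of a compatible family. -/
def glued : GraphWithColouredFins.{u} C where
  base := D.base
  fins := D.fins
  attach := D.attach
  two_edges := D.two_edges
  immersion := D.attach_isImmersion
  colour S := X.colour (p.finsHom.mapOriented p.finsHom_isImmersion S)

variable {Z : GraphWithColouredFins.{u} C} (q : D.CompatibleFamily Z)

/-- The map of the glued graph given by a compatible family. -/
def hom : Hom p.glued Z where
  onBase := q.baseHom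
  onFins := q.finsHom
  comm := by
    refine SerreGraph.Hom.ext (funext fun v => ?_) (funext fun f => ?_)
    · exact ((q.map v.1.1).attach_onV v.1.2).trans (congrArg (q.map v.1.1).onBase.onV v.2)
    · exact (q.map f.1.1).attach_onE f.1.2
  fins_immersion := q.finsHom_isImmersion
  map_colour := by
    rintro ⟨f⟩
    -- Both families preserve the colours of `T`, so colours pulled back through `p` agree with
    -- those seen through `q`.
    exact ((q.map f.1.1).colour_onE f.1.2).trans ((p.map f.1.1).colour_onE f.1.2).symm

/-- Gluing only decides how oriented edges are paired: the star of `i` is still the star of `D.pt i`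
in `T`, on which `q.map i` is bijective. Surjectivity is not local and has to be supplied. -/
lemma hom_isCovering (hq : ∀ i, (q.map i).IsCovering) (hZ : Z.base.IsConnected)
    (hs : Function.Surjective fun i => (q.map i).onBase.onV (D.pt i)) :
    (p.hom q).IsCovering := by
  refine ⟨hZ, ⟨hs, fun i e h => ?_⟩, ⟨fun v => ?_, ?_⟩, fun i v h => ?_⟩
  · obtain ⟨e', h1, h2⟩ := (hq i).exists_edge h
    refine ⟨⟨(i, e'), h1⟩, ⟨rfl, h2⟩, ?_⟩
    rintro ⟨⟨j, e''⟩, h3⟩ ⟨h4, h5⟩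
    have h4' : j = i := h4
    subst h4'
    exact Subtype.ext (Prod.ext rfl ((hq j).edge_unique (h3.trans h1.symm) (h5.trans h2.symm)))
  · obtain ⟨i, hi⟩ := hs (Z.attach.onV v)
    obtain ⟨v', h1, h2⟩ := (hq i).exists_finVertex hi.symm
    exact ⟨⟨(i, v'), h1⟩, h2⟩
  · rintro ⟨⟨i, v⟩, hv⟩ f h
    obtain ⟨f', ⟨h1, h2⟩, _⟩ := (hq i).2.2.1.2 v f h
    have hf : T.foot f' = D.pt i := by rw [← attach_src, h1]; exact hv
    refine ⟨⟨(i, f'), hf⟩, ⟨Subtype.ext (Prod.ext rfl h1), h2⟩, ?_⟩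
    rintro ⟨⟨j, f''⟩, h3⟩ ⟨h4, h5⟩
    have h4' : j = i := congrArg (fun v => v.1.1) h4
    subst h4'
    exact Subtype.ext (Prod.ext rfl ((hq j).finEdge_unique (h3.trans hf.symm) (h5.trans h2.symm)))
  · obtain ⟨v', h1, h2⟩ := (hq i).exists_finVertex h
    refine ⟨⟨(i, v'), h1⟩, ⟨rfl, h2⟩, ?_⟩
    rintro ⟨⟨j, v''⟩, h3⟩ ⟨h4, h5⟩
    have h4' : j = i := h4
    subst h4'
    exact Subtype.ext (Prod.ext rfl ((hq j).finVertex_unique (h3.trans h1.symm)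
      (h5.trans h2.symm)))

end CompatibleFamily

end Gluing

/-- A covering of a finite graph with finitely many vertices is finite. -/
lemma Hom.IsCovering.isFinite {Y : GraphWithColouredFins.{u} C} {Φ : Hom Y X} (hΦ : Φ.IsCovering)
    (hX : X.IsFinite) (hY : Finite Y.base.V) : Y.IsFinite := by
  obtain ⟨h1, h2, h3, h4⟩ := hX
  refine ⟨hY, ?_, ?_, ?_⟩
  · exact Finite.of_injective (fun e => (Y.base.src e, Φ.onBase.onE e)) fun e e' h =>
      hΦ.edge_unique (congrArg Prod.fst h) (congrArg Prod.snd h)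
  · exact Finite.of_injective (fun e => (Y.attach.onV e, Φ.onFins.onV e)) fun e e' h =>
      hΦ.finVertex_unique (congrArg Prod.fst h) (congrArg Prod.snd h)
  · exact Finite.of_injective (fun e => (Y.foot e, Φ.onFins.onE e)) fun e e' h =>
      hΦ.finEdge_unique (congrArg Prod.fst h) (congrArg Prod.snd h)

/-- An involution covering a given fixed point free involution of the set of types exists as soon
as opposite types are equally frequent. -/
lemma exists_involution {α β : Type*} [Finite α] (κ : α → β) (r : β → β)
    (hr : ∀ a, r (r (κ a)) = κ a) (hne : ∀ a, r (κ a) ≠ κ a)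
    (hcard : ∀ a, Nat.card {b // κ b = κ a} = Nat.card {b // κ b = r (κ a)}) :
    ∃ s : α → α, (∀ a, s (s a) = a) ∧ ∀ a, κ (s a) = r (κ a) := by
  classical
  -- An arbitrary order picks one type from each pair {k, r k}: the chosen bijection is used on the
  -- smaller type and its inverse on the larger one.
  let _ : LinearOrder β := IsWellOrder.linearOrder WellOrderingRel
  have hE : ∀ k : Set.range κ, Nonempty ({b // κ b = k.1} ≃ {b // κ b = r k.1}) := by
    rintro ⟨_, a, rfl⟩
    exact Finite.card_eq.1 (hcard a)
  let E (a : α) := (hE ⟨κ a, a, rfl⟩).some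
  have hrng : ∀ a, ∃ b, κ b = r (κ a) := fun a => ⟨(E a ⟨a, rfl⟩).1, (E a ⟨a, rfl⟩).2⟩
  let F (k : Set.range κ) : {b // κ b = k.1} ≃ {b // κ b = r k.1} := (hE k).some
  let R (k : Set.range κ) : Set.range κ := ⟨r k.1, by
    obtain ⟨_, a, rfl⟩ := k
    exact hrng a⟩
  have hRR : ∀ k, R (R k) = k := by
    rintro ⟨_, a, rfl⟩
    exact Subtype.ext (hr a)
  let t (a : α) : Set.range κ := ⟨κ a, a, rfl⟩
  let s (a : α) : α := if κ a < r (κ a) then (F (t a) ⟨a, rfl⟩).1 else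
    ((F (R (t a))).symm ⟨a, (hr a).symm⟩).1
  have hs : ∀ a, κ (s a) = r (κ a) := by
    intro a
    by_cases h : κ a < r (κ a)
    · simp only [s, if_pos h]
      exact (F (t a) ⟨a, rfl⟩).2
    · simp only [s, if_neg h]
      exact ((F (R (t a))).symm ⟨a, (hr a).symm⟩).2
  have hF : ∀ (k k' : Set.range κ) (h : k = k') (a : α) (ha : κ a = k.1) (ha' : κ a = k'.1),
      (F k ⟨a, ha⟩).1 = (F k' ⟨a, ha'⟩).1 := by
    rintro k _ rfl a ha ha'
    rfl
  have hF' : ∀ (k k' : Set.range κ) (h : k = k') (a : α) (ha : κ a = r k.1) (ha' : κ a = r k'.1),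
      ((F k).symm ⟨a, ha⟩).1 = ((F k').symm ⟨a, ha'⟩).1 := by
    rintro k _ rfl a ha ha'
    rfl
  refine ⟨s, fun a => ?_, hs⟩
  have ht : t (s a) = R (t a) := Subtype.ext (hs a)
  -- Passing from `a` to `s a` swaps the two cases, so the bijection meets its own inverse. In the
  -- second case `hne` supplies strictness.
  by_cases h : κ a < r (κ a)
  · have h' : ¬ κ (s a) < r (κ (s a)) := by
      rw [hs, hr]
      exact h.asymm
    have h1 : s (s a) = ((F (R (t (s a)))).symm ⟨s a, (hr _).symm⟩).1 := if_neg h'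
    have h2 : s a = (F (t a) ⟨a, rfl⟩).1 := if_pos h
    rw [h1, hF' (R (t (s a))) (t a) (by rw [ht, hRR]) _ _ (hs a)]
    have h3 : (⟨s a, hs a⟩ : {b // κ b = r (κ a)}) = F (t a) ⟨a, rfl⟩ := Subtype.ext h2
    exact congrArg Subtype.val ((congrArg (F (t a)).symm h3).trans ((F (t a)).symm_apply_apply _))
  · have h' : κ (s a) < r (κ (s a)) := by
      rw [hs, hr]
      exact lt_of_le_of_ne (not_lt.1 h) (hne a)
    have h1 : s (s a) = (F (t (s a)) ⟨s a, rfl⟩).1 := if_pos h'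
    have h2 : s a = ((F (R (t a))).symm ⟨a, (hr a).symm⟩).1 := if_neg h
    rw [h1, hF (t (s a)) (R (t a)) ht _ _ (hs a)]
    have h3 : (⟨s a, hs a⟩ : {b // κ b = (R (t a)).1}) =
      (F (R (t a))).symm ⟨a, (hr a).symm⟩ := Subtype.ext h2
    exact congrArg Subtype.val
      ((congrArg (F (R (t a))) h3).trans ((F (R (t a))).apply_symm_apply _))

end GraphWithColouredFins

/-! ### Counting cosets and images of orbits. -/

lemma ncard_image_eq_relIndex {G α : Type*} [Group G] (K L : Subgroup G) (φ : G → α)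
    (h : ∀ k ∈ L, ∀ k' ∈ L, φ k = φ k' ↔ k⁻¹ * k' ∈ K) : (φ '' L).ncard = K.relIndex L := by
  rw [Subgroup.relIndex, Subgroup.index, ← Nat.card_coe_set_eq]
  refine (Nat.card_congr (Equiv.ofBijective
    (fun c : L ⧸ K.subgroupOf L => (⟨φ c.out.1, c.out.1, c.out.2, rfl⟩ : φ '' (L : Set G)))
    ⟨fun c c' hc => ?_, ?_⟩)).symm
  · have h1 := (h _ c.out.2 _ c'.out.2).1 (congrArg Subtype.val hc)
    rw [← Quotient.out_eq' c, ← Quotient.out_eq' c']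
    exact QuotientGroup.eq.2 (Subgroup.mem_subgroupOf.2 h1)
  · rintro ⟨_, k, hk, rfl⟩
    refine ⟨((⟨k, hk⟩ : L) : L ⧸ K.subgroupOf L), Subtype.ext ?_⟩
    refine (h _ ((⟨k, hk⟩ : L) : L ⧸ K.subgroupOf L).out.2 _ hk).2 ?_
    have h1 : (((((⟨k, hk⟩ : L) : L ⧸ K.subgroupOf L).out : L)) : L ⧸ K.subgroupOf L) =
        ((⟨k, hk⟩ : L) : L ⧸ K.subgroupOf L) := Quotient.out_eq' _
    exact Subgroup.mem_subgroupOf.1 (QuotientGroup.eq.1 h1)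

/-- Counting the image of an orbit along an equivariant map, for compatible quotient maps. -/
lemma ncard_image_orbit {G A B A₁ B₁ : Type*} [Group G] [MulAction G A] [MulAction G B]
    (π : A → B) (hπ : ∀ (g : G) a, π (g • a) = g • π a) (p : A → A₁) (q : B → B₁) (π₁ : A₁ → B₁)
    (hpq : ∀ a, π₁ (p a) = q (π a)) (hinj : ∀ a a', p a = p a' → π a = π a' → a = a')
    (hdeck : ∀ b b', q b = q b' → ∃ γ : G, γ • b = b' ∧ ∀ a, p (γ • a) = p a) (a : A) :
    (p '' MulAction.orbit G a).ncard = (q '' MulAction.orbit G (π a)).ncard *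
      (MulAction.stabilizer G a).relIndex (MulAction.stabilizer G (π a)) := by
  rw [← ncard_image_eq_relIndex _ _ (fun k : G => k • a) (fun k _ k' _ => by
    rw [MulAction.mem_stabilizer_iff, mul_smul, inv_smul_eq_iff, eq_comm])]
  simp only [← Nat.card_coe_set_eq]
  rw [← Nat.card_prod]
  have hg : ∀ b : q '' MulAction.orbit G (π a), ∃ g : G, q (g • π a) = b.1 := by
    rintro ⟨_, _, ⟨g, rfl⟩, rfl⟩
    exact ⟨g, rfl⟩
  choose g hg using hg
  refine (Nat.card_congr (Equiv.ofBijective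
    (fun c : (q '' MulAction.orbit G (π a)) ×
      ((fun k : G => k • a) '' (MulAction.stabilizer G (π a) : Set G)) =>
      (⟨p (g c.1 • c.2.1), by
        obtain ⟨b, _, k, hk, rfl⟩ := c
        exact ⟨_, ⟨g b * k, mul_smul _ _ _⟩, rfl⟩⟩ : p '' MulAction.orbit G a)) ⟨?_, ?_⟩)).symm
  · rintro ⟨b, _, k, hk, rfl⟩ ⟨b', _, k', hk', rfl⟩ h
    have h0 : p (g b • k • a) = p (g b' • k' • a) := congrArg Subtype.val h
    have hk1 : k • π a = π a := hk
    have hk1' : k' • π a = π a := hk'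
    have h1 : b = b' := by
      have := congrArg π₁ h0
      rw [hpq, hpq, hπ, hπ, hπ, hπ, hk1, hk1', hg, hg] at this
      exact Subtype.ext this
    subst h1
    have h2 := hinj _ _ h0 (by rw [hπ, hπ, hπ, hπ, hk1, hk1'])
    have h3 := smul_left_cancel _ h2
    exact Prod.ext rfl (Subtype.ext h3)
  · rintro ⟨_, _, ⟨h, rfl⟩, rfl⟩
    let b : q '' MulAction.orbit G (π a) := ⟨q (h • π a), _, ⟨h, rfl⟩, rfl⟩
    -- A deck element carries the point to the chosen representative over `b` without changing its
    -- image under `p`; what remains is an element of the stabiliser of `π a`.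
    obtain ⟨γ, hγ, hγp⟩ := hdeck (h • π a) (g b • π a) (hg b).symm
    refine ⟨⟨b, ((g b)⁻¹ * γ * h) • a, (g b)⁻¹ * γ * h, ?_, rfl⟩, Subtype.ext ?_⟩
    · change ((g b)⁻¹ * γ * h) • π a = π a
      rw [mul_smul, mul_smul, hγ, inv_smul_smul]
    · change p (g b • ((g b)⁻¹ * γ * h) • a) = p (h • a)
      rw [mul_smul, mul_smul, smul_inv_smul, hγp]

/-! ### Fixers of stars and edges, and germs as classes of cosets. -/

namespace GraphWithColouredFins

variable {C : Type w} {X₁ X₂ T : GraphWithColouredFins.{u} C}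

/-- The elements that fix the star of a vertex, including the parts of the fins in it. -/
def starFixer (x : T.base.V) : Subgroup (Aut T) where
  carrier := {g | g • x = x ∧ (∀ e, T.base.src e = x → g • e = e) ∧
    ∀ f, T.foot f = x → g • f = f}
  one_mem' := ⟨one_smul _ _, fun _ _ => one_smul _ _, fun _ _ => one_smul _ _⟩
  mul_mem' := by
    rintro a b ⟨h1, h2, h3⟩ ⟨h1', h2', h3'⟩
    refine ⟨?_, fun e he => ?_, fun f hf => ?_⟩
    · rw [mul_smul, h1', h1]
    · rw [mul_smul, h2' e he, h2 e he]
    · rw [mul_smul, h3' f hf, h3 f hf]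
  inv_mem' := by
    rintro a ⟨h1, h2, h3⟩
    exact ⟨inv_smul_eq_iff.2 h1.symm, fun e he => inv_smul_eq_iff.2 (h2 e he).symm,
      fun f hf => inv_smul_eq_iff.2 (h3 f hf).symm⟩

/-- The elements that fix an oriented edge and the edges of fins along it. -/
def edgeFixer (e : T.base.E) : Subgroup (Aut T) where
  carrier := {g | g • e = e ∧ ∀ f, T.attach.onE f = e → g • f = f}
  one_mem' := ⟨one_smul _ _, fun _ _ => one_smul _ _⟩
  mul_mem' := by
    rintro a b ⟨h1, h2⟩ ⟨h1', h2'⟩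
    refine ⟨?_, fun f hf => ?_⟩
    · rw [mul_smul, h1', h1]
    · rw [mul_smul, h2' f hf, h2 f hf]
  inv_mem' := by
    rintro a ⟨h1, h2⟩
    exact ⟨inv_smul_eq_iff.2 h1.symm, fun f hf => inv_smul_eq_iff.2 (h2 f hf).symm⟩

lemma starFixer_le_edgeFixer (e : T.base.E) : starFixer (T.base.src e) ≤ edgeFixer e :=
  fun _ h => ⟨h.2.1 e rfl, fun f hf => h.2.2 f (by rw [foot, hf])⟩

lemma edgeFixer_le_stabilizer (e : T.base.E) :
    edgeFixer e ≤ MulAction.stabilizer (Aut T) e := fun _ h => h.1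

lemma stabilizer_edge_le (e : T.base.E) :
    MulAction.stabilizer (Aut T) e ≤ MulAction.stabilizer (Aut T) (T.base.src e) := by
  intro g h
  rw [MulAction.mem_stabilizer_iff] at h ⊢
  rw [← src_smul, h]

lemma stabilizer_finEdge_le (f : T.fins.E) :
    MulAction.stabilizer (Aut T) f ≤ MulAction.stabilizer (Aut T) (T.foot f) := by
  intro g h
  rw [MulAction.mem_stabilizer_iff] at h ⊢
  rw [← foot_smul, h]

lemma starFixer_le_stabilizer_finEdge (f : T.fins.E) :
    starFixer (T.foot f) ≤ MulAction.stabilizer (Aut T) f := fun _ h => h.2.2 f rfl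

lemma stabilizer_rev (e : T.base.E) :
    MulAction.stabilizer (Aut T) (T.base.rev e) = MulAction.stabilizer (Aut T) e := by
  ext g
  rw [MulAction.mem_stabilizer_iff, MulAction.mem_stabilizer_iff, ← rev_smul,
    T.base.rev_injective.eq_iff]

lemma edgeFixer_rev_le (e : T.base.E) : edgeFixer e ≤ edgeFixer (T.base.rev e) := by
  rintro g ⟨h1, h2⟩
  refine ⟨by rw [← rev_smul, h1], fun f hf => T.fins.rev_injective ?_⟩
  rw [finRev_smul]
  exact h2 _ (by rw [T.attach.map_rev, hf, T.base.rev_rev])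

lemma edgeFixer_rev (e : T.base.E) : edgeFixer (T.base.rev e) = edgeFixer e :=
  le_antisymm ((edgeFixer_rev_le _).trans (by rw [T.base.rev_rev])) (edgeFixer_rev_le e)

/-- Types of local identifications of stars in `X₁` with stars in `X₂`. -/
abbrev GermType (X₁ X₂ : GraphWithColouredFins.{u} C) : Type u :=
  X₁.base.V × X₂.base.V × Set (X₁.base.E × X₂.base.E) × Set (X₁.fins.E × X₂.fins.E)

/-- Types of identifications of oriented edges of `X₁` and `X₂` together with the fins at them. -/
abbrev EdgeGermType (X₁ X₂ : GraphWithColouredFins.{u} C) : Type u :=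
  X₁.base.E × X₂.base.E × Set (X₁.fins.E × X₂.fins.E)

section Germ

variable (Ψ₁ : Hom T X₁) (Ψ₂ : Hom T X₂)

/-- The local identification of stars induced by an automorphism at a vertex. -/
def germ (x : T.base.V) (g : Aut T) : GermType X₁ X₂ :=
  (Ψ₁.onBase.onV x, Ψ₂.onBase.onV (g • x),
    (fun e => (Ψ₁.onBase.onE e, Ψ₂.onBase.onE (g • e))) '' {e | T.base.src e = x},
    (fun f => (Ψ₁.onFins.onE f, Ψ₂.onFins.onE (g • f))) '' {f | T.foot f = x})

/-- The local identification of edges with fins induced by an automorphism at an edge. -/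
def edgeGerm (e : T.base.E) (g : Aut T) : EdgeGermType X₁ X₂ :=
  (Ψ₁.onBase.onE e, Ψ₂.onBase.onE (g • e),
    (fun f => (Ψ₁.onFins.onE f, Ψ₂.onFins.onE (g • f))) '' {f | T.attach.onE f = e})

/-- The local identifications of stars induced by automorphisms. -/
abbrev Germs : Type u := {r : GermType X₁ X₂ // ∃ x g, germ Ψ₁ Ψ₂ x g = r}

variable {Ψ₁ Ψ₂}

lemma germ_congr {x : T.base.V} {g g' : Aut T}
    (hV : Ψ₂.onBase.onV (g • x) = Ψ₂.onBase.onV (g' • x))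
    (hE : ∀ e, T.base.src e = x → Ψ₂.onBase.onE (g • e) = Ψ₂.onBase.onE (g' • e))
    (hF : ∀ f, T.foot f = x → Ψ₂.onFins.onE (g • f) = Ψ₂.onFins.onE (g' • f)) :
    germ Ψ₁ Ψ₂ x g = germ Ψ₁ Ψ₂ x g' := by
  rw [germ, germ, hV]
  exact Prod.ext rfl (Prod.ext rfl (Prod.ext
    (Set.image_congr fun e he => Prod.ext rfl (hE e he))
    (Set.image_congr fun f hf => Prod.ext rfl (hF f hf))))

/-- Since Ψ₁ is injective on the star of `x`, the sets of pairs in a germ are graphs of functions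
and determine their values. -/
lemma germ_eq_iff (h₁ : Ψ₁.IsCovering) {x : T.base.V} {g g' : Aut T} :
    germ Ψ₁ Ψ₂ x g = germ Ψ₁ Ψ₂ x g' ↔ Ψ₂.onBase.onV (g • x) = Ψ₂.onBase.onV (g' • x) ∧
      (∀ e, T.base.src e = x → Ψ₂.onBase.onE (g • e) = Ψ₂.onBase.onE (g' • e)) ∧
      ∀ f, T.foot f = x → Ψ₂.onFins.onE (g • f) = Ψ₂.onFins.onE (g' • f) := by
  refine ⟨fun h => ⟨congrArg (fun r => r.2.1) h, fun e he => ?_, fun f hf => ?_⟩,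
    fun h => germ_congr h.1 h.2.1 h.2.2⟩
  · have h1 : (Ψ₁.onBase.onE e, Ψ₂.onBase.onE (g • e)) ∈ (germ Ψ₁ Ψ₂ x g).2.2.1 := ⟨e, he, rfl⟩
    rw [h] at h1
    obtain ⟨e', he', h2⟩ := h1
    have h3 := h₁.edge_unique (he'.trans he.symm) (congrArg Prod.fst h2)
    rw [h3] at h2
    exact (congrArg Prod.snd h2).symm
  · have h1 : (Ψ₁.onFins.onE f, Ψ₂.onFins.onE (g • f)) ∈ (germ Ψ₁ Ψ₂ x g).2.2.2 := ⟨f, hf, rfl⟩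
    rw [h] at h1
    obtain ⟨f', hf', h2⟩ := h1
    have h3 := h₁.finEdge_unique (hf'.trans hf.symm) (congrArg Prod.fst h2)
    rw [h3] at h2
    exact (congrArg Prod.snd h2).symm

lemma edgeGerm_congr {e : T.base.E} {g g' : Aut T}
    (hE : Ψ₂.onBase.onE (g • e) = Ψ₂.onBase.onE (g' • e))
    (hF : ∀ f, T.attach.onE f = e → Ψ₂.onFins.onE (g • f) = Ψ₂.onFins.onE (g' • f)) :
    edgeGerm Ψ₁ Ψ₂ e g = edgeGerm Ψ₁ Ψ₂ e g' := by
  rw [edgeGerm, edgeGerm, hE]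
  exact Prod.ext rfl (Prod.ext rfl (Set.image_congr fun f hf => Prod.ext rfl (hF f hf)))

lemma finOnE_eq_of_edgeGerm_eq (h₁ : Ψ₁.IsCovering) {e e' : T.base.E} {g g' : Aut T}
    (h : edgeGerm Ψ₁ Ψ₂ e g = edgeGerm Ψ₁ Ψ₂ e' g') {f f' : T.fins.E} (hf : T.attach.onE f = e)
    (hf' : T.attach.onE f' = e') (hff : Ψ₁.onFins.onE f = Ψ₁.onFins.onE f') :
    Ψ₂.onFins.onE (g • f) = Ψ₂.onFins.onE (g' • f') := by
  have h1 : (Ψ₁.onFins.onE f, Ψ₂.onFins.onE (g • f)) ∈ (edgeGerm Ψ₁ Ψ₂ e g).2.2 := ⟨f, hf, rfl⟩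
  rw [h] at h1
  obtain ⟨f'', hf'', h2⟩ := h1
  have h3 := h₁.finEdge_unique_of_attach (hf''.trans hf'.symm)
    ((congrArg Prod.fst h2).trans hff)
  rw [h3] at h2
  exact (congrArg Prod.snd h2).symm

/-- Deck elements of Ψ₁ are invisible in the components from `X₁`. So germs at different points of a
fibre can all be compared at one point. -/
lemma germ_smul {γ : Aut T} (hγ : γ ∈ deckGroup Ψ₁) (x : T.base.V) (g : Aut T) :
    germ Ψ₁ Ψ₂ (γ • x) g = germ Ψ₁ Ψ₂ x (g * γ) := by
  have hE : {e | T.base.src e = γ • x} = (fun e => γ • e) '' {e | T.base.src e = x} := by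
    ext e
    refine ⟨fun h => ⟨γ⁻¹ • e, ?_, smul_inv_smul _ _⟩, ?_⟩
    · change T.base.src _ = x
      rw [src_smul, h, inv_smul_smul]
    · rintro ⟨e, rfl, rfl⟩
      exact src_smul γ e
  have hF : {f | T.foot f = γ • x} = (fun e => γ • e) '' {e | T.foot e = x} := by
    ext e
    refine ⟨fun h => ⟨γ⁻¹ • e, ?_, smul_inv_smul _ _⟩, ?_⟩
    · change T.foot _ = x
      rw [foot_smul, h, inv_smul_smul]
    · rintro ⟨e, rfl, rfl⟩
      exact foot_smul γ e
  rw [germ, germ, hE, hF, Set.image_image, Set.image_image, onV_deck hγ]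
  simp only [onE_deck hγ, finOnE_deck hγ, mul_smul]

lemma edgeGerm_smul {γ : Aut T} (hγ : γ ∈ deckGroup Ψ₁) (e : T.base.E) (g : Aut T) :
    edgeGerm Ψ₁ Ψ₂ (γ • e) g = edgeGerm Ψ₁ Ψ₂ e (g * γ) := by
  have hF : {f | T.attach.onE f = γ • e} = (fun e => γ • e) '' {f | T.attach.onE f = e} := by
    ext f
    refine ⟨fun h => ⟨γ⁻¹ • f, ?_, smul_inv_smul _ _⟩, ?_⟩
    · change T.attach.onE _ = e
      rw [attach_smul, h, inv_smul_smul]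
    · rintro ⟨f, rfl, rfl⟩
      exact attach_smul γ f
  rw [edgeGerm, edgeGerm, hF, Set.image_image, onE_deck hγ]
  simp only [finOnE_deck hγ, mul_smul]

lemma germ_deck_mul {δ : Aut T} (hδ : δ ∈ deckGroup Ψ₂) (x : T.base.V) (g : Aut T) :
    germ Ψ₁ Ψ₂ x (δ * g) = germ Ψ₁ Ψ₂ x g :=
  germ_congr (by rw [mul_smul, onV_deck hδ]) (fun e _ => by rw [mul_smul, onE_deck hδ])
    (fun f _ => by rw [mul_smul, finOnE_deck hδ])

lemma edgeGerm_deck_mul {δ : Aut T} (hδ : δ ∈ deckGroup Ψ₂) (e : T.base.E) (g : Aut T) :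
    edgeGerm Ψ₁ Ψ₂ e (δ * g) = edgeGerm Ψ₁ Ψ₂ e g :=
  edgeGerm_congr (by rw [mul_smul, onE_deck hδ]) (fun f _ => by rw [mul_smul, finOnE_deck hδ])

/-- Both translates of the star of `x` lie in the star of `g • x`, where Ψ₂ is injective, so equal
germs force `k` and `k'` to agree on the star. -/
lemma germ_mul_eq_iff (h₁ : Ψ₁.IsCovering) (h₂ : Ψ₂.IsCovering) (x : T.base.V) (g : Aut T)
    {k k' : Aut T} (hk : k • x = x) (hk' : k' • x = x) :
    germ Ψ₁ Ψ₂ x (g * k) = germ Ψ₁ Ψ₂ x (g * k') ↔ k⁻¹ * k' ∈ starFixer x := by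
  rw [germ_eq_iff h₁]
  have hV : ∀ {a b : T.base.V}, (k⁻¹ * k') • a = b ↔ k' • a = k • b := by
    intro a b
    rw [mul_smul, inv_smul_eq_iff]
  have hE : ∀ {a b : T.base.E}, (k⁻¹ * k') • a = b ↔ k' • a = k • b := by
    intro a b
    rw [mul_smul, inv_smul_eq_iff]
  have hF : ∀ {a b : T.fins.E}, (k⁻¹ * k') • a = b ↔ k' • a = k • b := by
    intro a b
    rw [mul_smul, inv_smul_eq_iff]
  constructor
  · rintro ⟨_, h2, h3⟩
    refine ⟨hV.2 (hk'.trans hk.symm), fun e he => hE.2 ?_, fun f hf => hF.2 ?_⟩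
    · have h4 := h2 e he
      rw [mul_smul, mul_smul] at h4
      exact (smul_left_cancel g (h₂.edge_unique (by simp only [src_smul, he, hk, hk']) h4)).symm
    · have h4 := h3 f hf
      rw [mul_smul, mul_smul] at h4
      exact (smul_left_cancel g (h₂.finEdge_unique (by simp only [foot_smul, hf, hk, hk']) h4)).symm
  · rintro ⟨h1, h2, h3⟩
    refine ⟨?_, fun e he => ?_, fun f hf => ?_⟩
    · rw [mul_smul, mul_smul, hk, hk']
    · rw [mul_smul, mul_smul, hE.1 (h2 e he)]
    · rw [mul_smul, mul_smul, hF.1 (h3 f hf)]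

/-- The number of germs in a class of germs given by a group that fixes a vertex. -/
lemma card_germs (h₁ : Ψ₁.IsCovering) (h₂ : Ψ₂.IsCovering) (x : T.base.V) (g : Aut T)
    (L : Subgroup (Aut T)) (hL : L ≤ MulAction.stabilizer (Aut T) x) (Q : Germs Ψ₁ Ψ₂ → Prop)
    (hQ : ∀ r, Q r ↔ ∃ k ∈ L, r.1 = germ Ψ₁ Ψ₂ x (g * k)) :
    Nat.card {r // Q r} = (starFixer x).relIndex L := by
  rw [← ncard_image_eq_relIndex _ _ (fun k => germ Ψ₁ Ψ₂ x (g * k))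
    (fun k hk k' hk' => germ_mul_eq_iff h₁ h₂ x g (hL hk) (hL hk')), ← Nat.card_coe_set_eq]
  refine Nat.card_congr (Equiv.ofBijective (fun r => ⟨r.1.1, ?_⟩)
    ⟨fun r r' h => ?_, ?_⟩)
  · obtain ⟨k, hk, h⟩ := (hQ r.1).1 r.2
    exact ⟨k, hk, h.symm⟩
  · have h' := congrArg Subtype.val h
    exact Subtype.ext (Subtype.ext h')
  · rintro ⟨_, k, hk, rfl⟩
    exact ⟨⟨⟨_, x, g * k, rfl⟩, (hQ _).2 ⟨k, hk, rfl⟩⟩, rfl⟩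

lemma exists_deck_of_germ_eq (h₁ : Ψ₁.IsUniversalCovering) {x x' : T.base.V} {g g' : Aut T}
    (h : germ Ψ₁ Ψ₂ x' g' = germ Ψ₁ Ψ₂ x g) :
    ∃ γ ∈ deckGroup Ψ₁, γ • x = x' ∧ germ Ψ₁ Ψ₂ x (g' * γ) = germ Ψ₁ Ψ₂ x g := by
  obtain ⟨γ, hγ, rfl⟩ := h₁.exists_smul_eq (a := x) (b := x') (congrArg Prod.fst h).symm
  exact ⟨γ, hγ, rfl, by rw [← germ_smul hγ, h]⟩

lemma exists_vertex_iff (h₁ : Ψ₁.IsUniversalCovering) (h₂ : Ψ₂.IsUniversalCovering)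
    (x : T.base.V) (g : Aut T) (r : Germs Ψ₁ Ψ₂) :
    (r.1.1 = Ψ₁.onBase.onV x ∧ r.1.2.1 = Ψ₂.onBase.onV (g • x)) ↔
      ∃ k ∈ MulAction.stabilizer (Aut T) x, r.1 = germ Ψ₁ Ψ₂ x (g * k) := by
  constructor
  · obtain ⟨_, x', g', rfl⟩ := r
    rintro ⟨h, h'⟩
    obtain ⟨γ, hγ, rfl⟩ := h₁.exists_smul_eq (a := x) (b := x') h.symm
    obtain ⟨δ, hδ, h3⟩ := h₂.exists_smul_eq (a := g' • γ • x) (b := g • x) h'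
    -- This `k` solves g k = δ g' γ: the deck elements γ and δ move the second germ to the vertex
    -- `x` and its image to `g • x`.
    refine ⟨g⁻¹ * (δ * (g' * γ)), ?_, ?_⟩
    · rw [MulAction.mem_stabilizer_iff, mul_smul, mul_smul, mul_smul, h3, inv_smul_smul]
    · rw [mul_inv_cancel_left, germ_deck_mul hδ]
      exact germ_smul hγ x g'
  · rintro ⟨k, hk, h⟩
    rw [h]
    refine ⟨rfl, ?_⟩
    change Ψ₂.onBase.onV ((g * k) • x) = _
    rw [mul_smul, MulAction.mem_stabilizer_iff.1 hk]

/-- Up to deck elements on either side, two germs containing the same edge germ differ by an element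
fixing the edge and the fins along it. This makes the number of pieces with a given edge germ a
subgroup index. -/
lemma exists_edge_iff (h₁ : Ψ₁.IsUniversalCovering) (h₂ : Ψ₂.IsUniversalCovering)
    (e : T.base.E) (g : Aut T) (x' : T.base.V) (g' : Aut T) :
    (∃ e', T.base.src e' = x' ∧ edgeGerm Ψ₁ Ψ₂ e' g' = edgeGerm Ψ₁ Ψ₂ e g) ↔
      ∃ k ∈ edgeFixer e, germ Ψ₁ Ψ₂ x' g' = germ Ψ₁ Ψ₂ (T.base.src e) (g * k) := by
  constructor
  · rintro ⟨e', rfl, h⟩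
    obtain ⟨γ, hγ, rfl⟩ := h₁.exists_smul_edge_eq (a := e) (b := e') (congrArg Prod.fst h).symm
    rw [edgeGerm_smul hγ] at h
    obtain ⟨δ, hδ, h2⟩ := h₂.exists_smul_edge_eq (a := (g' * γ) • e) (b := g • e)
      (congrArg (fun r => r.2.1) h)
    rw [← edgeGerm_deck_mul hδ] at h
    refine ⟨g⁻¹ * (δ * (g' * γ)), ⟨?_, fun f hf => ?_⟩, ?_⟩
    · rw [mul_smul, mul_smul, h2, inv_smul_smul]
    · have h3 := finOnE_eq_of_edgeGerm_eq h₁.1 h hf hf rfl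
      rw [mul_smul, inv_smul_eq_iff]
      refine h₂.1.finEdge_unique_of_attach ?_ h3
      rw [attach_smul, attach_smul, hf, mul_smul, h2]
    · rw [mul_inv_cancel_left, germ_deck_mul hδ, src_smul]
      exact germ_smul hγ _ g'
  · rintro ⟨k, hk, h⟩
    obtain ⟨γ, hγ, rfl, h2⟩ := exists_deck_of_germ_eq h₁ h
    obtain ⟨_, h3, h4⟩ := (germ_eq_iff h₁.1).1 h2
    refine ⟨γ • e, src_smul _ _, ?_⟩
    rw [edgeGerm_smul hγ]
    refine edgeGerm_congr ?_ fun f hf => ?_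
    · rw [h3 e rfl, mul_smul, hk.1]
    · rw [h4 f (by rw [foot, hf]), mul_smul, hk.2 f hf]

/-- Here only one edge of a fin is prescribed and other fins along the same base edge may move, so
the full stabiliser of `f` takes the place of `edgeFixer`. -/
lemma exists_finEdge_iff (h₁ : Ψ₁.IsUniversalCovering) (h₂ : Ψ₂.IsUniversalCovering)
    (f : T.fins.E) (g : Aut T) (x' : T.base.V) (g' : Aut T) :
    (∃ f', T.foot f' = x' ∧ Ψ₁.onFins.onE f' = Ψ₁.onFins.onE f ∧
        Ψ₂.onFins.onE (g' • f') = Ψ₂.onFins.onE (g • f)) ↔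
      ∃ k ∈ MulAction.stabilizer (Aut T) f,
        germ Ψ₁ Ψ₂ x' g' = germ Ψ₁ Ψ₂ (T.foot f) (g * k) := by
  constructor
  · rintro ⟨f', rfl, h, h'⟩
    obtain ⟨γ, hγ, rfl⟩ := h₁.exists_smul_finEdge_eq (a := f) (b := f') h.symm
    obtain ⟨δ, hδ, h2⟩ := h₂.exists_smul_finEdge_eq (a := g' • γ • f) (b := g • f) h'
    refine ⟨g⁻¹ * (δ * (g' * γ)), ?_, ?_⟩
    · rw [MulAction.mem_stabilizer_iff, mul_smul, mul_smul, mul_smul, h2, inv_smul_smul]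
    · rw [mul_inv_cancel_left, germ_deck_mul hδ, foot_smul]
      exact germ_smul hγ _ g'
  · rintro ⟨k, hk, h⟩
    obtain ⟨γ, hγ, rfl, h2⟩ := exists_deck_of_germ_eq h₁ h
    obtain ⟨_, _, h4⟩ := (germ_eq_iff h₁.1).1 h2
    refine ⟨γ • f, foot_smul _ _, finOnE_deck hγ f, ?_⟩
    rw [← mul_smul, h4 f rfl, mul_smul, MulAction.mem_stabilizer_iff.1 hk]

end Germ

end GraphWithColouredFins

/-! ### Weights of germs and weighted counts. -/

lemma exists_weights {α : Type*} [Finite α] (d : α → ℕ) (hd : ∀ a, 0 < d a) :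
    ∃ N, 0 < N ∧ ∃ w : α → ℕ, ∀ a, w a * d a = N := by
  classical
  have := Fintype.ofFinite α
  refine ⟨∏ a, d a, Finset.prod_pos fun a _ => hd a, fun a => (∏ a, d a) / d a, fun a => ?_⟩
  exact Nat.div_mul_cancel (Finset.dvd_prod_of_mem d (Finset.mem_univ a))

namespace GraphWithColouredFins

variable {C : Type w} {X₁ X₂ T : GraphWithColouredFins.{u} C} {Ψ₁ : Hom T X₁} {Ψ₂ : Hom T X₂}

/-- The number of vertices that are of the same type as a given vertex. -/
noncomputable def typeCount (Ψ₁ : Hom T X₁) (y : X₁.base.V) : ℕ :=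
  {z | ∃ (x : T.base.V) (g : Aut T), Ψ₁.onBase.onV x = y ∧ Ψ₁.onBase.onV (g • x) = z}.ncard

/-- The definition ranges over the whole fibre so as to depend on a vertex of `X₁` alone;
transitivity of the deck group reduces it to a single orbit. -/
lemma typeCount_eq (h₁ : Ψ₁.IsUniversalCovering) (x : T.base.V) :
    typeCount Ψ₁ (Ψ₁.onBase.onV x) =
      (Ψ₁.onBase.onV '' MulAction.orbit (Aut T) x).ncard := by
  rw [typeCount]
  congr 1
  ext z
  constructor
  · rintro ⟨x', g, h, rfl⟩
    obtain ⟨γ, hγ, rfl⟩ := h₁.exists_smul_eq (a := x) (b := x') h.symm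
    exact ⟨_, ⟨g * γ, mul_smul _ _ _⟩, rfl⟩
  · rintro ⟨_, ⟨g, rfl⟩, rfl⟩
    exact ⟨x, g, rfl, rfl⟩

lemma ncard_edge_orbit (h₁ : Ψ₁.IsUniversalCovering) (e : T.base.E) :
    (Ψ₁.onBase.onE '' MulAction.orbit (Aut T) e).ncard =
      typeCount Ψ₁ (Ψ₁.onBase.onV (T.base.src e)) *
        (MulAction.stabilizer (Aut T) e).relIndex
          (MulAction.stabilizer (Aut T) (T.base.src e)) := by
  rw [typeCount_eq h₁]
  refine ncard_image_orbit T.base.src src_smul Ψ₁.onBase.onE Ψ₁.onBase.onV X₁.base.src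
    (fun e => (Ψ₁.onBase.map_src e).symm) (fun e e' h h' => h₁.1.edge_unique h' h)
    (fun b b' h => ?_) e
  obtain ⟨γ, hγ, h2⟩ := h₁.exists_smul_eq h
  exact ⟨γ, h2, onE_deck hγ⟩

lemma ncard_finEdge_orbit (h₁ : Ψ₁.IsUniversalCovering) (f : T.fins.E) :
    (Ψ₁.onFins.onE '' MulAction.orbit (Aut T) f).ncard =
      typeCount Ψ₁ (Ψ₁.onBase.onV (T.foot f)) *
        (MulAction.stabilizer (Aut T) f).relIndex
          (MulAction.stabilizer (Aut T) (T.foot f)) := by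
  rw [typeCount_eq h₁]
  refine ncard_image_orbit T.foot foot_smul Ψ₁.onFins.onE Ψ₁.onBase.onV X₁.foot
    Ψ₁.foot_onE (fun e e' h h' => h₁.1.finEdge_unique h' h) (fun b b' h => ?_) f
  obtain ⟨γ, hγ, h2⟩ := h₁.exists_smul_eq h
  exact ⟨γ, h2, finOnE_deck hγ⟩

lemma ncard_rev_orbit (Ψ₁ : Hom T X₁) (e : T.base.E) :
    (Ψ₁.onBase.onE '' MulAction.orbit (Aut T) (T.base.rev e)).ncard =
      (Ψ₁.onBase.onE '' MulAction.orbit (Aut T) e).ncard := by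
  rw [← Set.ncard_image_of_injective _ X₁.base.rev_injective]
  congr 1
  ext z
  constructor
  · rintro ⟨_, ⟨_, ⟨g, rfl⟩, rfl⟩, rfl⟩
    refine ⟨_, ⟨g, rfl⟩, ?_⟩
    simp only [← Ψ₁.onBase.map_rev, rev_smul, T.base.rev_rev]
  · rintro ⟨_, ⟨g, rfl⟩, rfl⟩
    refine ⟨_, ⟨_, ⟨g, rfl⟩, rfl⟩, ?_⟩
    simp only [← Ψ₁.onBase.map_rev, rev_smul, T.base.rev_rev]

/-- The denominator of the weight of a germ. -/
noncomputable def germDenominator (r : Germs Ψ₁ Ψ₂) : ℕ :=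
  typeCount Ψ₁ r.1.1 * Nat.card {s : Germs Ψ₁ Ψ₂ // s.1.1 = r.1.1 ∧ s.1.2.1 = r.1.2.1}

lemma germDenominator_eq (h₁ : Ψ₁.IsUniversalCovering) (h₂ : Ψ₂.IsUniversalCovering)
    (x : T.base.V) (g : Aut T) {r : Germs Ψ₁ Ψ₂} {k : Aut T}
    (hk : k ∈ MulAction.stabilizer (Aut T) x) (hr : r.1 = germ Ψ₁ Ψ₂ x (g * k)) :
    germDenominator r = typeCount Ψ₁ (Ψ₁.onBase.onV x) *
      (starFixer x).relIndex (MulAction.stabilizer (Aut T) x) := by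
  obtain ⟨hr1, hr2⟩ := (exists_vertex_iff h₁ h₂ x g r).2 ⟨k, hk, hr⟩
  rw [germDenominator, hr1, hr2, card_germs h₁.1 h₂.1 x g _ le_rfl _ (exists_vertex_iff h₁ h₂ x g)]

lemma finite_germs (hX₁ : X₁.IsFinite) (hX₂ : X₂.IsFinite) : Finite (Germs Ψ₁ Ψ₂) := by
  obtain ⟨_, _, _, _⟩ := hX₁
  obtain ⟨_, _, _, _⟩ := hX₂
  infer_instance

lemma germDenominator_pos (hX₁ : X₁.IsFinite) (hX₂ : X₂.IsFinite) (r : Germs Ψ₁ Ψ₂) :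
    0 < germDenominator r := by
  have := finite_germs (Ψ₁ := Ψ₁) (Ψ₂ := Ψ₂) hX₁ hX₂
  have := hX₁.1
  refine Nat.mul_pos ?_ ?_
  · obtain ⟨_, x, g, rfl⟩ := r
    exact (Set.ncard_pos (Set.toFinite _)).2 ⟨_, x, 1, rfl, rfl⟩
  · have : Nonempty {s : Germs Ψ₁ Ψ₂ // s.1.1 = r.1.1 ∧ s.1.2.1 = r.1.2.1} := ⟨⟨r, rfl, rfl⟩⟩
    exact Nat.card_pos

section Weights

variable {w : Germs Ψ₁ Ψ₂ → ℕ} {N : ℕ}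

/-- All germs of the class have the same denominator, hence the same weight, and the class has [L :
Fix(star x)] members. The tower law cancels this index against the denominator, leaving [G_x : L].
-/
lemma card_weighted_germs (h₁ : Ψ₁.IsUniversalCovering) (h₂ : Ψ₂.IsUniversalCovering)
    (hN : 0 < N) (hw : ∀ r, w r * germDenominator r = N) (x : T.base.V) (g : Aut T)
    (L : Subgroup (Aut T)) (hL : L ≤ MulAction.stabilizer (Aut T) x) (hK : starFixer x ≤ L)
    (Q : Germs Ψ₁ Ψ₂ → Prop) (hQ : ∀ r, Q r ↔ ∃ k ∈ L, r.1 = germ Ψ₁ Ψ₂ x (g * k)) :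
    Nat.card {i : Σ r, Fin (w r) // Q i.1} * (typeCount Ψ₁ (Ψ₁.onBase.onV x) *
      L.relIndex (MulAction.stabilizer (Aut T) x)) = N := by
  let r₀ : Germs Ψ₁ Ψ₂ := ⟨germ Ψ₁ Ψ₂ x g, x, g, rfl⟩
  have hd : ∀ r, Q r → germDenominator r = typeCount Ψ₁ (Ψ₁.onBase.onV x) *
      (starFixer x).relIndex (MulAction.stabilizer (Aut T) x) := by
    intro r hr
    obtain ⟨k, hk, h⟩ := (hQ r).1 hr
    exact germDenominator_eq h₁ h₂ x g (hL hk) h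
  have hr₀ : Q r₀ := (hQ r₀).2 ⟨1, L.one_mem, by rw [mul_one]⟩
  have hwr : ∀ r, Q r → w r = w r₀ := by
    intro r hr
    have h3 : 0 < germDenominator r :=
      Nat.pos_of_ne_zero fun h => by
        have := hw r
        rw [h, mul_zero] at this
        omega
    refine Nat.eq_of_mul_eq_mul_right h3 ?_
    rw [hw, hd r hr, ← hd r₀ hr₀, hw]
  have hcard : Nat.card {i : Σ r, Fin (w r) // Q i.1} = Nat.card {r // Q r} * w r₀ := by
    rw [← Nat.card_fin (w r₀), ← Nat.card_prod]
    exact Nat.card_congr ⟨fun i => (⟨i.1.1, i.2⟩, Fin.cast (hwr _ i.2) i.1.2),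
      fun p => ⟨⟨p.1.1, Fin.cast (hwr _ p.1.2).symm p.2⟩, p.1.2⟩, fun _ => rfl, fun _ => rfl⟩
  rw [hcard, card_germs h₁.1 h₂.1 x g L hL Q hQ, ← hw r₀, hd r₀ hr₀,
    ← Subgroup.relIndex_mul_relIndex _ _ _ hK hL]
  ring

variable {pt : Germs Ψ₁ Ψ₂ → T.base.V} {tr : Germs Ψ₁ Ψ₂ → Aut T}

/-- The case `L = edgeFixer e`. Splitting the index at the stabiliser of `e` absorbs the vertex
count into an edge count, and both resulting factors are invariant under reversal of `e`. A piece
has at most one edge with the given germ because Ψ₁ is injective on stars. -/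
lemma card_edges_with_germ (h₁ : Ψ₁.IsUniversalCovering) (h₂ : Ψ₂.IsUniversalCovering)
    (hN : 0 < N) (hw : ∀ r, w r * germDenominator r = N)
    (hrep : ∀ r, germ Ψ₁ Ψ₂ (pt r) (tr r) = r.1) (e : T.base.E) (g : Aut T) :
    Nat.card {p : {p : (Σ r, Fin (w r)) × T.base.E // T.base.src p.2 = pt p.1.1} //
      edgeGerm Ψ₁ Ψ₂ p.1.2 (tr p.1.1.1) = edgeGerm Ψ₁ Ψ₂ e g} *
      ((Ψ₁.onBase.onE '' MulAction.orbit (Aut T) e).ncard *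
        (edgeFixer e).relIndex (MulAction.stabilizer (Aut T) e)) = N := by
  rw [ncard_edge_orbit h₁, ← card_weighted_germs h₁ h₂ hN hw (T.base.src e) g (edgeFixer e)
    ((edgeFixer_le_stabilizer e).trans (stabilizer_edge_le e)) (starFixer_le_edgeFixer e)
    (fun r => ∃ e', T.base.src e' = pt r ∧ edgeGerm Ψ₁ Ψ₂ e' (tr r) = edgeGerm Ψ₁ Ψ₂ e g)
    (fun r => by rw [exists_edge_iff h₁ h₂, hrep]),
    ← Subgroup.relIndex_mul_relIndex _ _ _ (edgeFixer_le_stabilizer e) (stabilizer_edge_le e)]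
  rw [mul_assoc, mul_comm (Subgroup.relIndex _ _) (Subgroup.relIndex _ _)]
  congr 1
  refine Nat.card_congr (Equiv.ofBijective
    (fun p => ⟨p.1.1.1, p.1.1.2, p.1.2, p.2⟩) ⟨?_, ?_⟩)
  · rintro ⟨⟨⟨i, e'⟩, h⟩, h'⟩ ⟨⟨⟨j, e''⟩, hj⟩, hj'⟩ hp
    have hij : i = j := congrArg Subtype.val hp
    subst hij
    have := h₁.1.edge_unique (h.trans hj.symm) (congrArg Prod.fst (h'.trans hj'.symm))
    exact Subtype.ext (Subtype.ext (Prod.ext rfl this))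
  · rintro ⟨i, e', h, h'⟩
    exact ⟨⟨⟨(i, e'), h⟩, h'⟩, rfl⟩

lemma card_finEdges_over (h₁ : Ψ₁.IsUniversalCovering) (h₂ : Ψ₂.IsUniversalCovering)
    (hN : 0 < N) (hw : ∀ r, w r * germDenominator r = N)
    (hrep : ∀ r, germ Ψ₁ Ψ₂ (pt r) (tr r) = r.1) (f : T.fins.E) (g : Aut T) :
    Nat.card {p : {p : (Σ r, Fin (w r)) × T.fins.E // T.foot p.2 = pt p.1.1} //
      Ψ₁.onFins.onE p.1.2 = Ψ₁.onFins.onE f ∧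
        Ψ₂.onFins.onE (tr p.1.1.1 • p.1.2) = Ψ₂.onFins.onE (g • f)} *
      (Ψ₁.onFins.onE '' MulAction.orbit (Aut T) f).ncard = N := by
  rw [ncard_finEdge_orbit h₁, ← card_weighted_germs h₁ h₂ hN hw (T.foot f) g
    (MulAction.stabilizer (Aut T) f) (stabilizer_finEdge_le f) (starFixer_le_stabilizer_finEdge f)
    (fun r => ∃ f', T.foot f' = pt r ∧ Ψ₁.onFins.onE f' = Ψ₁.onFins.onE f ∧
      Ψ₂.onFins.onE (tr r • f') = Ψ₂.onFins.onE (g • f))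
    (fun r => by rw [exists_finEdge_iff h₁ h₂, hrep])]
  congr 1
  refine Nat.card_congr (Equiv.ofBijective
    (fun p => ⟨p.1.1.1, p.1.1.2, p.1.2, p.2⟩) ⟨?_, ?_⟩)
  · rintro ⟨⟨⟨i, e'⟩, h⟩, h'⟩ ⟨⟨⟨j, e''⟩, hj⟩, hj'⟩ hp
    have hij : i = j := congrArg Subtype.val hp
    subst hij
    have := h₁.1.finEdge_unique (h.trans hj.symm) (h'.1.trans hj'.1.symm)
    exact Subtype.ext (Subtype.ext (Prod.ext rfl this))
  · rintro ⟨i, e', h, h'⟩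
    exact ⟨⟨⟨(i, e'), h⟩, h'⟩, rfl⟩

end Weights

end GraphWithColouredFins

/-! ### Construction of the common covering. -/

namespace GraphWithColouredFins

variable {C : Type w} {X₁ X₂ T : GraphWithColouredFins.{u} C} {Ψ₁ : Hom T X₁} {Ψ₂ : Hom T X₂}

/-- The identification of the reversed edges. -/
def EdgeGermType.rev (k : EdgeGermType X₁ X₂) : EdgeGermType X₁ X₂ :=
  (X₁.base.rev k.1, X₂.base.rev k.2.1, Prod.map X₁.fins.rev X₂.fins.rev '' k.2.2)

lemma edgeGerm_rev (e : T.base.E) (g : Aut T) :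
    edgeGerm Ψ₁ Ψ₂ (T.base.rev e) g = EdgeGermType.rev (edgeGerm Ψ₁ Ψ₂ e g) := by
  refine Prod.ext (Ψ₁.onBase.map_rev e) (Prod.ext ?_ ?_)
  · change Ψ₂.onBase.onE (g • T.base.rev e) = _
    rw [← rev_smul, Ψ₂.onBase.map_rev]
    rfl
  · have hF : {f | T.attach.onE f = T.base.rev e} = T.fins.rev '' {f | T.attach.onE f = e} := by
      ext f
      refine ⟨fun h => ⟨T.fins.rev f, ?_, T.fins.rev_rev f⟩, ?_⟩
      · change T.attach.onE _ = e
        rw [T.attach.map_rev, h, T.base.rev_rev]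
      · rintro ⟨f, rfl, rfl⟩
        exact T.attach.map_rev f
    change _ '' {f | T.attach.onE f = T.base.rev e} = _ '' (_ '' _)
    rw [hF, Set.image_image, Set.image_image]
    simp only [← finRev_smul, Ψ₁.onFins.map_rev, Ψ₂.onFins.map_rev, Prod.map_apply]

/-- Two finite graphs with coloured fins with a common universal cover have a finite common covering
in which each pair of edges of fins of the same type occurs with the frequency that is inversely
proportional to the number of edges of fins of this type. -/
theorem exists_common_covering (hX₁ : X₁.IsFinite) (hX₂ : X₂.IsFinite)
    (h₁ : Ψ₁.IsUniversalCovering) (h₂ : Ψ₂.IsUniversalCovering) :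
    ∃ (Y : GraphWithColouredFins.{u} C) (Φ₁ : Hom Y X₁) (Φ₂ : Hom Y X₂),
      Y.IsFinite ∧ Φ₁.IsCovering ∧ Φ₂.IsCovering ∧
      (∀ p : Y.fins.E, ∃ (f : T.fins.E) (g : Aut T), Φ₁.onFins.onE p = Ψ₁.onFins.onE f ∧
        Φ₂.onFins.onE p = Ψ₂.onFins.onE (g • f)) ∧
      ∃ N, 0 < N ∧ ∀ (f : T.fins.E) (g : Aut T),
        Nat.card {p : Y.fins.E // Φ₁.onFins.onE p = Ψ₁.onFins.onE f ∧
          Φ₂.onFins.onE p = Ψ₂.onFins.onE (g • f)} *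
        (Ψ₁.onFins.onE '' MulAction.orbit (Aut T) f).ncard = N := by
  have hfin := finite_germs (Ψ₁ := Ψ₁) (Ψ₂ := Ψ₂) hX₁ hX₂
  obtain ⟨N, hN, w, hw⟩ := exists_weights (germDenominator (Ψ₁ := Ψ₁) (Ψ₂ := Ψ₂))
    (germDenominator_pos hX₁ hX₂)
  have hwpos : ∀ r, 0 < w r := fun r => Nat.pos_of_ne_zero fun h => by
    have := hw r
    rw [h, zero_mul] at this
    omega
  have hrep : ∀ r : Germs Ψ₁ Ψ₂, ∃ (x : T.base.V) (g : Aut T), germ Ψ₁ Ψ₂ x g = r.1 := fun r => r.2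
  choose pt tr hrep using hrep
  let α := {p : (Σ r, Fin (w r)) × T.base.E // T.base.src p.2 = pt p.1.1}
  have hα : Finite α := by
    have := hX₁.2.1
    refine Finite.of_injective
      (fun p : α => ((p.1.1, Ψ₁.onBase.onE p.1.2) : (Σ r, Fin (w r)) × X₁.base.E)) ?_
    rintro ⟨⟨i, e⟩, h⟩ ⟨⟨j, e'⟩, h'⟩ hp
    have hij : i = j := congrArg Prod.fst hp
    subst hij
    exact Subtype.ext (Prod.ext rfl (h₁.1.edge_unique (h.trans h'.symm) (congrArg Prod.snd hp)))
  let κ : α → EdgeGermType X₁ X₂ := fun p => edgeGerm Ψ₁ Ψ₂ p.1.2 (tr p.1.1.1)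
  have hκ : ∀ p : α, EdgeGermType.rev (κ p) =
      edgeGerm Ψ₁ Ψ₂ (T.base.rev p.1.2) (tr p.1.1.1) := fun p => (edgeGerm_rev _ _).symm
  -- Pair each oriented edge of a piece with one carrying the reversed edge germ.
  obtain ⟨s, hs, hsκ⟩ := exists_involution κ EdgeGermType.rev
    (fun p => by rw [hκ, ← edgeGerm_rev, T.base.rev_rev])
    (fun p h => X₁.base.rev_ne _ (congrArg Prod.fst h))
    (fun p => by
      rw [hκ]
      have h3 := card_edges_with_germ h₁ h₂ hN hw hrep p.1.2 (tr p.1.1.1)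
      have h4 := card_edges_with_germ h₁ h₂ hN hw hrep (T.base.rev p.1.2) (tr p.1.1.1)
      rw [ncard_rev_orbit, edgeFixer_rev, stabilizer_rev] at h4
      -- The two counts have the same cofactor, which is nonzero because the product is `N > 0`.
      refine Nat.eq_of_mul_eq_mul_right (Nat.pos_of_ne_zero fun h0 => ?_) (h3.trans h4.symm)
      rw [h0, mul_zero] at h3
      omega)
  have hs' : ∀ p : α, edgeGerm Ψ₁ Ψ₂ (s p).1.2 (tr (s p).1.1.1) =
      edgeGerm Ψ₁ Ψ₂ (T.base.rev p.1.2) (tr p.1.1.1) := fun p => (hsκ p).trans (hκ p)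
  let β := {p : (Σ r, Fin (w r)) × T.fins.E // T.foot p.2 = pt p.1.1}
  let a : β → α := fun f => ⟨(f.1.1, T.attach.onE f.1.2), f.2⟩
  -- The reversal of fin edges is forced by Ψ₁: take the fin edge along the partner edge that lies
  -- over the reverse in `X₁`. Equality of edge germs later makes it compatible with the maps to
  -- `X₂`.
  have hlift : ∀ f : β, ∃ f' : T.fins.E, T.attach.onE f' = (s (a f)).1.2 ∧
      Ψ₁.onFins.onE f' = X₁.fins.rev (Ψ₁.onFins.onE f.1.2) := fun f =>
    h₁.1.exists_finEdge_attach (by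
      rw [X₁.attach.map_rev, Ψ₁.attach_onE, ← Ψ₁.onBase.map_rev]
      exact (congrArg Prod.fst (hs' (a f))).symm)
  choose t ht ht' using hlift
  let fr : β → β := fun f => ⟨((s (a f)).1.1, t f), by
    change T.base.src (T.attach.onE (t f)) = _
    rw [ht]
    exact (s (a f)).2⟩
  have hafr : ∀ f, a (fr f) = s (a f) := fun f => Subtype.ext (Prod.ext rfl (ht f))
  have hext : ∀ f f' : β, a f = a f' → Ψ₁.onFins.onE f.1.2 = Ψ₁.onFins.onE f'.1.2 → f = f' := by
    intro f f' h h'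
    exact Subtype.ext (Prod.ext (congrArg (fun p => p.1.1) h)
      (h₁.1.finEdge_unique_of_attach (congrArg (fun p => p.1.2) h) h'))
  let D : Gluing T :=
    { I := Σ r, Fin (w r)
      pt := fun i => pt i.1
      rev := s
      rev_rev := hs
      rev_ne := fun p h => X₁.base.rev_ne (Ψ₁.onBase.onE p.1.2) (by
        rw [← Ψ₁.onBase.map_rev]
        have := congrArg Prod.fst (hs' p)
        rw [h] at this
        exact this.symm)
      finRev := fr
      finRev_finRev := fun f => hext _ _ (by rw [hafr, hafr, hs])
        ((ht' _).trans ((congrArg _ (ht' f)).trans (X₁.fins.rev_rev _)))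
      attach_finRev := fun f => (hafr f).symm }
  let p : D.CompatibleFamily X₁ :=
    { map := fun _ => Ψ₁
      rev := fun e => (congrArg Prod.fst (hs' e)).trans (Ψ₁.onBase.map_rev _)
      finRev := ht' }
  let q : D.CompatibleFamily X₂ :=
    { map := fun i => Ψ₂.comp (tr i.1).val
      rev := fun e => by
        have h3 := congrArg (fun k => k.2.1) (hs' e)
        change _ = Ψ₂.onBase.onE (tr e.1.1.1 • T.base.rev e.1.2) at h3
        rw [← rev_smul, Ψ₂.onBase.map_rev] at h3
        exact h3
      finRev := fun f => by
        have h3 := finOnE_eq_of_edgeGerm_eq h₁.1 (hs' (a f)) (ht f)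
          (T.attach.map_rev f.1.2) ((ht' f).trans (Ψ₁.onFins.map_rev _).symm)
        rw [← finRev_smul, Ψ₂.onFins.map_rev] at h3
        exact h3 }
  have hcov : (p.hom p).IsCovering := by
    refine p.hom_isCovering p (fun _ => h₁.1) h₁.1.1 fun y => ?_
    obtain ⟨x, rfl⟩ := h₁.1.2.1.1 y
    -- The germ of the identity at `x` occurs, as all weights are positive; so every vertex is hit.
    let r : Germs Ψ₁ Ψ₂ := ⟨germ Ψ₁ Ψ₂ x 1, x, 1, rfl⟩
    exact ⟨⟨r, 0, hwpos r⟩, congrArg Prod.fst (hrep r)⟩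
  refine ⟨p.glued, p.hom p, p.hom q, hcov.isFinite hX₁ ?_, hcov, ?_, ?_, N, hN, ?_⟩
  · change Finite (Σ r, Fin (w r))
    infer_instance
  · refine p.hom_isCovering q (fun i => h₂.1.comp_aut _) h₂.1.1 fun y => ?_
    obtain ⟨x, rfl⟩ := h₂.1.2.1.1 y
    let r : Germs Ψ₁ Ψ₂ := ⟨germ Ψ₁ Ψ₂ x 1, x, 1, rfl⟩
    exact ⟨⟨r, 0, hwpos r⟩, congrArg (fun k => k.2.1) (hrep r)⟩
  · rintro ⟨⟨i, f⟩, _⟩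
    exact ⟨f, tr i.1, rfl, rfl⟩
  · exact card_finEdges_over h₁ h₂ hN hw hrep

end GraphWithColouredFins

/-! ### Degrees, densities, and dependence of orbit counts on colour alone. -/

lemma card_mul_eq_of_fibres {α β : Type*} [Finite α] [Finite β] (φ : α → β) {n N : ℕ}
    (h : ∀ b, Nat.card {a // φ a = b} * n = N) : Nat.card α * n = Nat.card β * N := by
  have := Fintype.ofFinite β
  rw [← Nat.card_congr (Equiv.sigmaFiberEquiv φ), Nat.card_sigma, Finset.sum_mul,
    Finset.sum_congr rfl fun b _ => h b, Finset.sum_const, smul_eq_mul, Nat.card_eq_fintype_card,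
    Finset.card_univ]

namespace SerreGraph

variable {G K : SerreGraph.{u}}

lemma finsum_length (G : SerreGraph.{u}) [Finite G.E] (A : Set G.OrientedComponent) :
    ∑ᶠ S ∈ A, (G.length S : ℚ) = Nat.card {e : G.E // G.orientedComponent e ∈ A} := by
  classical
  have : Finite G.OrientedComponent := Finite.of_surjective G.orientedComponent Quot.mk_surjective
  have := Fintype.ofFinite A
  rw [← finsum_set_coe_eq_finsum_mem, finsum_eq_sum_of_fintype, ← Nat.cast_sum]
  congr 1
  let φ : {e : G.E // G.orientedComponent e ∈ A} → A := fun e => ⟨G.orientedComponent e.1, e.2⟩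
  rw [← Nat.card_congr (Equiv.sigmaFiberEquiv φ), Nat.card_sigma]
  refine Finset.sum_congr rfl fun S _ => Nat.card_congr ?_
  exact ⟨fun e => ⟨⟨e.1, by rw [e.2]; exact S.2⟩, Subtype.ext e.2⟩,
    fun e => ⟨e.1.1, Subtype.ext_iff.1 e.2⟩, fun _ => rfl, fun _ => rfl⟩

lemma Hom.IsImmersion.next {f : Hom G K} (hf : f.IsImmersion) {e e' : G.E} (h : G.Next e e') :
    K.Next (f.onE e) (f.onE e') := by
  refine ⟨?_, fun h' => h.2 (hf _ _ h.1 (h'.trans (f.map_rev e).symm))⟩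
  rw [← f.map_src, h.1, f.map_tgt]

lemma exists_next (hG : ∀ x, Nat.card {e : G.E // G.src e = x} = 2) (e : G.E) :
    ∃ e', G.Next e e' := by
  have h1 := (Nat.card_eq_two_iff' (⟨G.rev e, rfl⟩ : {e' : G.E // G.src e' = G.tgt e})).1
    (hG (G.tgt e))
  obtain ⟨e', h, _⟩ := h1
  exact ⟨e'.1, e'.2, fun h' => h (Subtype.ext h')⟩

lemma eq_of_ne_of_ne (hG : ∀ x, Nat.card {e : G.E // G.src e = x} = 2) {a b c : G.E}
    (hb : G.src b = G.src a) (hc : G.src c = G.src a) (hba : b ≠ a) (hca : c ≠ a) : b = c := by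
  have h1 := (Nat.card_eq_two_iff' (⟨a, rfl⟩ : {e : G.E // G.src e = G.src a})).1 (hG (G.src a))
  exact congrArg Subtype.val (h1.unique (y₁ := ⟨b, hb⟩) (y₂ := ⟨c, hc⟩)
    (fun h => hba (congrArg Subtype.val h)) (fun h => hca (congrArg Subtype.val h)))

lemma Next.right_unique (hG : ∀ x, Nat.card {e : G.E // G.src e = x} = 2) {e a b : G.E}
    (ha : G.Next e a) (hb : G.Next e b) : a = b :=
  eq_of_ne_of_ne hG (a := G.rev e) ha.1 hb.1 ha.2 hb.2

lemma Next.left_unique (hG : ∀ x, Nat.card {e : G.E // G.src e = x} = 2) {e a b : G.E}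
    (ha : G.Next a e) (hb : G.Next b e) : a = b :=
  G.rev_injective (eq_of_ne_of_ne hG (a := e) ha.1.symm hb.1.symm ha.2.symm hb.2.symm)

namespace Hom.IsCovering

variable {p : Hom G K}

lemma card_edge_fibre (hp : p.IsCovering) (e : K.E) :
    Nat.card {e' // p.onE e' = e} = Nat.card {y // p.onV y = K.src e} := by
  refine Nat.card_congr (Equiv.ofBijective
    (fun e' => ⟨G.src e'.1, by rw [p.map_src, e'.2]⟩) ⟨fun a b h => ?_, fun y => ?_⟩)
  · exact Subtype.ext (hp.isImmersion _ _ (congrArg Subtype.val h) (a.2.trans b.2.symm))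
  · obtain ⟨e', h1, h2⟩ := (hp.2 y.1 e y.2.symm).exists
    exact ⟨⟨e', h2⟩, Subtype.ext h1⟩

lemma card_fibre_eq (hp : p.IsCovering) (hK : K.IsConnected) (x y : K.V) :
    Nat.card {z // p.onV z = x} = Nat.card {z // p.onV z = y} := by
  induction hK.2 x y with
  | refl => rfl
  | tail _ h ih =>
    obtain ⟨e, rfl, rfl⟩ := h
    rw [ih, ← hp.card_edge_fibre, tgt, ← hp.card_edge_fibre]
    refine Nat.card_congr ⟨fun e' => ⟨G.rev e'.1, by rw [p.map_rev, e'.2]⟩,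
      fun e' => ⟨G.rev e'.1, by rw [p.map_rev, e'.2, K.rev_rev]⟩,
      fun _ => Subtype.ext (G.rev_rev _), fun _ => Subtype.ext (G.rev_rev _)⟩

end Hom.IsCovering

end SerreGraph

namespace GraphWithColouredFins

variable {C : Type w} {X Y T : GraphWithColouredFins.{u} C}

/-- A covering of finite graphs with coloured fins has a degree. -/
lemma Hom.IsCovering.exists_degree {Φ : Hom Y X} (hΦ : Φ.IsCovering) (hX : X.IsFinite)
    (hY : Y.IsFinite) : ∃ d, 0 < d ∧ Y.size = X.size * d ∧
      ∀ A : Set X.OrientedFin,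
        Nat.card {f : Y.fins.E // X.fins.orientedComponent (Φ.onFins.onE f) ∈ A} =
          Nat.card {f : X.fins.E // X.fins.orientedComponent f ∈ A} * d := by
  have := hX.1
  have := hX.2.2.2
  have := hY.1
  have := hY.2.2.2
  obtain ⟨x₀⟩ := hΦ.1.1
  refine ⟨Nat.card {z // Φ.onBase.onV z = x₀}, ?_, ?_, fun A => ?_⟩
  · obtain ⟨y, hy⟩ := hΦ.2.1.1 x₀
    have : Nonempty {z // Φ.onBase.onV z = x₀} := ⟨⟨y, hy⟩⟩
    exact Nat.card_pos
  · rw [size, ← mul_one (Nat.card Y.base.V)]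
    exact card_mul_eq_of_fibres Φ.onBase.onV fun x => by
      rw [mul_one, hΦ.2.1.card_fibre_eq hΦ.1 x x₀]
  · rw [← mul_one (Nat.card {f : Y.fins.E // _})]
    refine card_mul_eq_of_fibres (fun f => ⟨Φ.onFins.onE f.1, f.2⟩) fun f => ?_
    -- The fibre over a fin edge is in bijection with the fibre over its foot, so the degree on fin
    -- edges equals the degree on vertices.
    rw [mul_one, hΦ.2.1.card_fibre_eq hΦ.1 x₀ (X.foot f.1)]
    refine Nat.card_congr (Equiv.ofBijective (fun f' => ⟨Y.foot f'.1.1, ?_⟩)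
      ⟨fun a b h => ?_, fun y => ?_⟩)
    · rw [← Φ.foot_onE, ← congrArg Subtype.val f'.2]
    · refine Subtype.ext (Subtype.ext (hΦ.finEdge_unique (congrArg Subtype.val h) ?_))
      exact congrArg Subtype.val (a.2.trans b.2.symm)
    · obtain ⟨f', h1, h2⟩ := hΦ.exists_finEdge y.2.symm
      exact ⟨⟨⟨f', by rw [h2]; exact f.2⟩, Subtype.ext h2⟩, Subtype.ext h1⟩

lemma density_eq (hX : X.IsFinite) (c : C) : X.density c =
    Nat.card {f : X.fins.E // X.colour (X.fins.orientedComponent f) = c} / X.size := by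
  have := hX.2.2.2
  rw [density, X.fins.finsum_length]
  rfl

lemma Hom.IsCovering.density_eq {Φ : Hom Y X} (hΦ : Φ.IsCovering) (hX : X.IsFinite)
    (hY : Y.IsFinite) (c : C) : Y.density c = X.density c := by
  obtain ⟨d, hd, h1, h2⟩ := hΦ.exists_degree hX hY
  have h3 := h2 {S | X.colour S = c}
  simp only [Set.mem_ofPred_eq, Φ.colour_onE] at h3
  rw [GraphWithColouredFins.density_eq hX, GraphWithColouredFins.density_eq hY, h1, h3]
  push_cast
  exact mul_div_mul_right _ _ (by positivity)

/-- Every oriented fin edge has a unique successor and at most one predecessor. The successor map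
commutes with immersions and preserves oriented fins, so it carries one image of an orbit
bijectively onto the other. -/
lemma ncard_finEdge_orbit_next (Ψ : Hom T X) (P : X.OrientedFin → Prop) {f f' : T.fins.E}
    (h : T.fins.Next f f') :
    {z ∈ Ψ.onFins.onE '' MulAction.orbit (Aut T) f | P (X.fins.orientedComponent z)}.ncard =
      {z ∈ Ψ.onFins.onE '' MulAction.orbit (Aut T) f' |
        P (X.fins.orientedComponent z)}.ncard := by
  choose s hs using SerreGraph.exists_next X.two_edges
  have hsinj : Function.Injective s := fun a b hab =>
    (hs a).left_unique X.two_edges (by rw [hab]; exact hs b)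
  have hsg : ∀ g : Aut T, s (Ψ.onFins.onE (g • f)) = Ψ.onFins.onE (g • f') := fun g =>
    (hs _).right_unique X.two_edges (Ψ.fins_immersion.next (g.val.fins_immersion.next h))
  have hsc : ∀ z, X.fins.orientedComponent (s z) = X.fins.orientedComponent z := fun z =>
    (Quot.sound (hs z)).symm
  rw [← Set.ncard_image_of_injective _ hsinj]
  congr 1
  ext z
  constructor
  · rintro ⟨_, ⟨⟨_, ⟨g, rfl⟩, rfl⟩, hP⟩, rfl⟩
    exact ⟨⟨_, ⟨g, rfl⟩, (hsg g).symm⟩, by rwa [hsc]⟩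
  · rintro ⟨⟨_, ⟨g, rfl⟩, rfl⟩, hP⟩
    refine ⟨_, ⟨⟨_, ⟨g, rfl⟩, rfl⟩, ?_⟩, hsg g⟩
    rw [← hsc]
    have := hsg g
    rw [← this] at hP
    exact hP

/-- The numbers of edges of fins of a given type depend on the colour only. -/
lemma ncard_finEdge_orbit_eq
    (htrans : ∀ S S' : T.OrientedFin, T.colour S = T.colour S' →
      ∃ h : Aut T, h.val.onOrientedFins S = S')
    (Ψ : Hom T X) (P : X.OrientedFin → Prop) {f f' : T.fins.E}
    (h : T.colour (T.fins.orientedComponent f) = T.colour (T.fins.orientedComponent f')) :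
    {z ∈ Ψ.onFins.onE '' MulAction.orbit (Aut T) f | P (X.fins.orientedComponent z)}.ncard =
      {z ∈ Ψ.onFins.onE '' MulAction.orbit (Aut T) f' |
        P (X.fins.orientedComponent z)}.ncard := by
  obtain ⟨g, hg⟩ := htrans _ _ h
  -- Transitivity only matches oriented fins, so `g • f` and `f'` may differ by a shift along the
  -- fin, handled one step at a time.
  have h1 : Relation.EqvGen T.fins.Next (g • f) f' := Quot.eqvGen_exact hg
  rw [← MulAction.orbit_smul g f]
  generalize g • f = a at h1 ⊢
  clear hg h
  induction h1 with
  | rel _ _ h => exact ncard_finEdge_orbit_next Ψ P h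
  | refl => rfl
  | symm _ _ _ ih => exact ih.symm
  | trans _ _ _ _ _ ih ih' => exact ih.trans ih'

end GraphWithColouredFins

/-! ### Equidistribution and the final count. -/

namespace GraphWithColouredFins

variable {C : Type w} {X₁ X₂ T Y : GraphWithColouredFins.{u} C}

/-- The number of edges of fins that cover an oriented fin of `X₁` and a given edge of a fin of
`X₂`. -/
lemma card_row {Ψ₁ : Hom T X₁} {Ψ₂ : Hom T X₂} (hX₁ : X₁.IsFinite) (hY : Y.IsFinite)
    (h₂ : Ψ₂.IsUniversalCovering) {Φ₁ : Hom Y X₁} {Φ₂ : Hom Y X₂}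
    (hΦ : ∀ p : Y.fins.E, ∃ (f : T.fins.E) (g : Aut T), Φ₁.onFins.onE p = Ψ₁.onFins.onE f ∧
      Φ₂.onFins.onE p = Ψ₂.onFins.onE (g • f)) {N : ℕ}
    (hN : ∀ (f : T.fins.E) (g : Aut T),
      Nat.card {p : Y.fins.E // Φ₁.onFins.onE p = Ψ₁.onFins.onE f ∧
        Φ₂.onFins.onE p = Ψ₂.onFins.onE (g • f)} *
      (Ψ₁.onFins.onE '' MulAction.orbit (Aut T) f).ncard = N)
    (P : X₁.OrientedFin → Prop) (f : T.fins.E) :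
    Nat.card {p : Y.fins.E // P (X₁.fins.orientedComponent (Φ₁.onFins.onE p)) ∧
        Φ₂.onFins.onE p = Ψ₂.onFins.onE f} *
      (Ψ₁.onFins.onE '' MulAction.orbit (Aut T) f).ncard =
    {z ∈ Ψ₁.onFins.onE '' MulAction.orbit (Aut T) f |
      P (X₁.fins.orientedComponent z)}.ncard * N := by
  have := hX₁.2.2.2
  have := hY.2.2.2
  rw [← Nat.card_coe_set_eq {z ∈ _ | _}]
  have hmem : ∀ p, Φ₂.onFins.onE p = Ψ₂.onFins.onE f →
      Φ₁.onFins.onE p ∈ Ψ₁.onFins.onE '' MulAction.orbit (Aut T) f := by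
    intro p hp
    obtain ⟨f', g, h, h'⟩ := hΦ p
    obtain ⟨δ, hδ, h3⟩ := h₂.exists_smul_finEdge_eq (a := f) (b := g • f')
      (hp.symm.trans h')
    refine ⟨f', ⟨g⁻¹ * δ, ?_⟩, h.symm⟩
    change (g⁻¹ * δ) • f = f'
    rw [mul_smul, h3, inv_smul_smul]
  refine card_mul_eq_of_fibres (fun p => ⟨Φ₁.onFins.onE p.1, hmem p.1 p.2.2, p.2.1⟩) ?_
  rintro ⟨_, ⟨_, ⟨g, rfl⟩, rfl⟩, hP⟩
  -- This choice prescribes `g • f` over `X₁` while keeping `f` over `X₂`, and it leaves the orbit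
  -- unchanged.
  have h3 := hN (g • f) g⁻¹
  rw [MulAction.orbit_smul, inv_smul_smul] at h3
  rw [← h3]
  congr 1
  refine Nat.card_congr ⟨fun p => ⟨p.1.1, Subtype.ext_iff.1 p.2, p.1.2.2⟩,
    fun p => ⟨⟨p.1, ?_, p.2.2⟩, Subtype.ext p.2.1⟩, fun _ => rfl, fun _ => rfl⟩
  rw [p.2.1]
  exact hP

end GraphWithColouredFins

theorem theorem4p5 {C : Type w} (X₁ X₂ Xt : GraphWithColouredFins.{u} C)
    (hX₁ : X₁.IsFinite) (hX₂ : X₂.IsFinite)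
    (Ψ₁ : GraphWithColouredFins.Hom Xt X₁) (Ψ₂ : GraphWithColouredFins.Hom Xt X₂)
    (hΨ₁ : Ψ₁.IsUniversalCovering) (hΨ₂ : Ψ₂.IsUniversalCovering)
    (H : Subgroup Xt.Aut)
    (hH₁ : GraphWithColouredFins.deckGroup Ψ₁ ≤ H)
    (hH₂ : GraphWithColouredFins.deckGroup Ψ₂ ≤ H)
    (htrans : ∀ S T : Xt.OrientedFin, Xt.colour S = Xt.colour T →
      ∃ h ∈ H, h.val.onOrientedFins S = T) :
    (∀ c : C, X₁.density c = X₂.density c) ∧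
    ∃ (Xh : GraphWithColouredFins.{u} C)
      (Φ₁ : GraphWithColouredFins.Hom Xh X₁) (Φ₂ : GraphWithColouredFins.Hom Xh X₂),
      Xh.IsFinite ∧ Φ₁.IsCovering ∧ Φ₂.IsCovering ∧
      ∀ (c : C) (S₁ : X₁.OrientedFin) (S₂ : X₂.OrientedFin),
        X₁.colour S₁ = c → X₂.colour S₂ = c →
        ∑ᶠ S ∈ GraphWithColouredFins.commonFins Φ₁ Φ₂ S₁ S₂, (Xh.len S : ℚ) =
          (Xh.size : ℚ) / (X₁.density c * X₁.size * X₂.size) * (X₁.len S₁ * X₂.len S₂) := by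
  obtain ⟨Y, Φ₁, Φ₂, hY, hΦ₁, hΦ₂, hΦ, N, hN, hcount⟩ :=
    GraphWithColouredFins.exists_common_covering hX₁ hX₂ hΨ₁ hΨ₂
  have hdens : ∀ c : C, X₁.density c = X₂.density c := fun c =>
    (hΦ₁.density_eq hX₁ hY c).symm.trans (hΦ₂.density_eq hX₂ hY c)
  refine ⟨hdens, Y, Φ₁, Φ₂, hY, hΦ₁, hΦ₂, ?_⟩
  rintro c S₁ S₂ rfl hS₂
  have htr : ∀ S T : Xt.OrientedFin, Xt.colour S = Xt.colour T →
      ∃ h : Xt.Aut, h.val.onOrientedFins S = T := fun S T h =>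
    let ⟨g, _, hg⟩ := htrans S T h
    ⟨g, hg⟩
  have := hX₁.1
  have := hX₂.1
  have := hX₂.2.2.2
  have := hY.2.2.2
  have : Nonempty X₂.base.V := hΨ₂.1.1.1
  have hsize₂ : (X₂.size : ℚ) ≠ 0 := Nat.cast_ne_zero.2 Nat.card_pos.ne'
  have : Nonempty X₁.base.V := hΨ₁.1.1.1
  have hsize₁ : (X₁.size : ℚ) ≠ 0 := Nat.cast_ne_zero.2 Nat.card_pos.ne'
  obtain ⟨d, -, hd, hd'⟩ := hΦ₁.exists_degree hX₁ hY
  -- Edges of fins over `S₁` are equidistributed over the edges of fins in `X₂` of the same colour.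
  obtain ⟨R, hR⟩ : ∃ R : ℕ, ∀ z : X₂.fins.E,
      X₂.colour (X₂.fins.orientedComponent z) = X₁.colour S₁ →
      Nat.card {p : Y.fins.E // X₁.fins.orientedComponent (Φ₁.onFins.onE p) = S₁ ∧
        Φ₂.onFins.onE p = z} = R := by
    -- An edge of `S₂` serves as reference: it has the right colour, and every other edge of that
    -- colour is compared with it.
    obtain ⟨z₀, rfl⟩ := Quot.mk_surjective S₂
    have hlift : ∀ z : X₂.fins.E, ∃ f, Ψ₂.onFins.onE f = z := fun z => by
      obtain ⟨x, hx⟩ := hΨ₂.1.2.1.1 (X₂.foot z)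
      obtain ⟨f, -, hf⟩ := hΨ₂.1.exists_finEdge hx.symm
      exact ⟨f, hf⟩
    obtain ⟨f₀, rfl⟩ := hlift z₀
    refine ⟨Nat.card {p : Y.fins.E // X₁.fins.orientedComponent (Φ₁.onFins.onE p) = S₁ ∧
      Φ₂.onFins.onE p = Ψ₂.onFins.onE f₀}, fun z hz => ?_⟩
    obtain ⟨f, rfl⟩ := hlift z
    have h3 := GraphWithColouredFins.card_row hX₁ hY hΨ₂ hΦ hcount (fun S => S = S₁) f
    have h4 := GraphWithColouredFins.card_row hX₁ hY hΨ₂ hΦ hcount (fun S => S = S₁) f₀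
    have hc : Xt.colour (Xt.fins.orientedComponent f) =
        Xt.colour (Xt.fins.orientedComponent f₀) := by
      rw [← Ψ₂.colour_onE, ← Ψ₂.colour_onE, hz]
      exact hS₂.symm
    -- With the trivial predicate this compares the full orbit counts, that is, the cofactors in
    -- `h3` and `h4`.
    have h5 := GraphWithColouredFins.ncard_finEdge_orbit_eq htr Ψ₁ (fun _ => True) hc
    simp only [and_true, Set.ofPred_mem_eq] at h5
    rw [GraphWithColouredFins.ncard_finEdge_orbit_eq htr Ψ₁ (fun S => S = S₁) hc, h5, ← h4] at h3
    refine Nat.eq_of_mul_eq_mul_right (Nat.pos_of_ne_zero fun h0 => ?_) h3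
    have h6 := hcount f₀ 1
    rw [h0, mul_zero] at h6
    omega
  -- Summing `R` over all edges of the colour counts everything over `S₁`; summing over `S₂` alone,
  -- in `hpair`, counts the common part. Eliminating `R` gives the result.
  have hall : Nat.card {p : Y.fins.E // X₁.fins.orientedComponent (Φ₁.onFins.onE p) = S₁} * 1 =
      Nat.card {z : X₂.fins.E // X₂.colour (X₂.fins.orientedComponent z) = X₁.colour S₁} * R := by
    have hcol : ∀ p : Y.fins.E, X₁.fins.orientedComponent (Φ₁.onFins.onE p) = S₁ →
        X₂.colour (X₂.fins.orientedComponent (Φ₂.onFins.onE p)) = X₁.colour S₁ := by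
      intro p hp
      rw [Φ₂.colour_onE, ← Φ₁.colour_onE, hp]
    refine card_mul_eq_of_fibres (fun p => ⟨Φ₂.onFins.onE p.1, hcol p.1 p.2⟩) fun z => ?_
    rw [mul_one, ← hR z.1 z.2]
    exact Nat.card_congr ⟨fun p => ⟨p.1.1, p.1.2, Subtype.ext_iff.1 p.2⟩,
      fun p => ⟨⟨p.1, p.2.1⟩, Subtype.ext p.2.2⟩, fun _ => rfl, fun _ => rfl⟩
  have hpair : Nat.card {p : Y.fins.E // X₁.fins.orientedComponent (Φ₁.onFins.onE p) = S₁ ∧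
      X₂.fins.orientedComponent (Φ₂.onFins.onE p) = S₂} * 1 = X₂.len S₂ * R := by
    refine card_mul_eq_of_fibres (β := {z : X₂.fins.E // X₂.fins.orientedComponent z = S₂})
      (fun p => ⟨Φ₂.onFins.onE p.1, p.2.2⟩) fun z => ?_
    rw [mul_one, ← hR z.1 (by rw [z.2, hS₂])]
    exact Nat.card_congr ⟨fun p => ⟨p.1.1, p.1.2.1, Subtype.ext_iff.1 p.2⟩,
      fun p => ⟨⟨p.1, p.2.1, by rw [p.2.2]; exact z.2⟩, Subtype.ext p.2.2⟩,
      fun _ => rfl, fun _ => rfl⟩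
  have hdeg : Nat.card {p : Y.fins.E // X₁.fins.orientedComponent (Φ₁.onFins.onE p) = S₁} =
      X₁.len S₁ * d := hd' {S₁}
  have hpos : (Nat.card {z : X₂.fins.E //
      X₂.colour (X₂.fins.orientedComponent z) = X₁.colour S₁} : ℚ) ≠ 0 := by
    obtain ⟨z, rfl⟩ := Quot.mk_surjective S₂
    have : Nonempty {z : X₂.fins.E //
      X₂.colour (X₂.fins.orientedComponent z) = X₁.colour S₁} := ⟨⟨z, hS₂⟩⟩
    exact Nat.cast_ne_zero.2 Nat.card_pos.ne'
  have hsum : ∑ᶠ S ∈ GraphWithColouredFins.commonFins Φ₁ Φ₂ S₁ S₂, (Y.len S : ℚ) =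
      Nat.card {p : Y.fins.E // X₁.fins.orientedComponent (Φ₁.onFins.onE p) = S₁ ∧
        X₂.fins.orientedComponent (Φ₂.onFins.onE p) = S₂} := Y.fins.finsum_length _
  rw [mul_one] at hall hpair
  rw [hsum, hpair, hdens, GraphWithColouredFins.density_eq hX₂, hd]
  rw [hdeg] at hall
  have hall' : (X₁.len S₁ * d : ℚ) = Nat.card {z : X₂.fins.E //
      X₂.colour (X₂.fins.orientedComponent z) = X₁.colour S₁} * R := by exact_mod_cast hall
  push_cast
  field_simp
  linear_combination (-(X₂.len S₂ : ℚ)) * hall'
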